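/- Let $q$ be a prime power, let $m,n,r$ be positive integers such that $m$ divides $rn$, and write $[i]=q^i$. View $\mathbb{F}_{q^m}$ and $\mathbb{F}_{q^r}$ as subfields of $\mathbb{F}_{q^{rn}}$. \emph{Codes.} Let $C\subseteq\mathbb{F}_{q^m}^n$ be an $\mathbb{F}_{q^m}$-linear $q^r$-cyclic code, i.e. $(c_{n-1}^{[r]},c_0^{[r]},\ldots,c_{n-2}^{[r]})\in C$ for all $(c_0,c_1,\ldots,c_{n-1})\in C$. The rank weight of a vector over $\mathbb{F}_{q^m}$ is the dimension of the $\mathbb{F}_q$-linear span of its components. A linear space $V\subseteq\mathbb{F}_{q^m}^n$ is Galois closed if it is stable under raising all components to the power $q$. Linear codes $C\subseteq\mathbb{F}_{q^m}^n$ and $C'\subseteq\mathbb{F}_{q^m}^{n'}$ are rank equivalent if there are linear Galois closed spaces $V\supseteq C$, $V'\supseteq C'$ and an $\mathbb{F}_{q^m}$-linear isomorphism $\phi:V\to V'$ that preserves rank weights and satisfies $\phi(C)=C'$. The rank length $l_R(C)$ is the minimum $n'\ge 0$ such that $C$ is rank equivalent to a linear code of length $n'$. \emph{Linearized polynomials.}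 Let $\mathcal{L}$ be the ring of polynomials $F(x)=F_0x+F_1x^{[r]}+\cdots+F_dx^{[dr]}$ with $F_i\in\mathbb{F}_{q^m}$, with composition $\otimes$ as product; put $\deg_{q^r}F=d$ if $F_d\neq 0$. Divisibility is on the right ($A$ divides $B$ if $B=Q\otimes A$ for some $Q\in\mathcal{L}$), and $\gcd$ and $\mathrm{lcm}$ are the monic ones for this divisibility. Let $\theta_i$ act on $\mathcal{L}$ by raising every coefficient to the power $[i]$. Identify $(c_0,\ldots,c_{n-1})\in\mathbb{F}_{q^m}^n$ with the residue class of $c_0x+c_1x^{[r]}+\cdots+c_{n-1}x^{[(n-1)r]}$ modulo the two-sided ideal of $\mathcal{L}$ generated by $x^{[rn]}-x$. Let $G$ be the generator polynomial of $C$, i.e. the monic polynomial of minimal $q^r$-degree among the nonzero elements of $\mathcal{L}$ with residue class in $C$, and let $H\in\mathcal{L}$ be its check polynomial, i.e. $G\otimes H=H\otimes G=x^{[rn]}-x$. Write $H=H_0x+H_1x^{[r]}+\cdots+H_kx^{[kr]}$ with $H_k\ne0$, and put $$H^\perp(x)=\sum_{i=0}^{k}\frac{H_{k-i}^{[ir]}}{H_0^{[kr]}}\,x^{[ir]}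 .$$ For $F\in\mathcal{L}$ let $Z(F)$ be the $\mathbb{F}_{q^r}$-linear space of zeroes of $F$ in $\mathbb{F}_{q^{rn}}$, and for a subspace $W$ let $W^{[i]}=\{w^{[i]} : w\in W\}$. Then the following $\gcd$ and $\mathrm{lcm}$ exist and are unique, and $$l_R(C)=n-\deg_{q^r}\bigl(\gcd(G,\theta_1(G),\ldots,\theta_{m-1}(G))\bigr)=\deg_{q^r}\bigl(\mathrm{lcm}(H^\perp,\theta_1(H^\perp),\ldots,\theta_{m-1}(H^\perp))\bigr)$$ $$=n-\dim_{\mathbb{F}_{q^r}}\Bigl(\bigcap_{i=0}^{m-1}Z(G)^{[i]}\Bigr)=\dim_{\mathbb{F}_{q^r}}\Bigl(\sum_{i=0}^{m-1}Z(H^\perp)^{[i]}\Bigr).$$ -/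

import Mathlib

open Polynomial

namespace SkewCyclic

section Codes

/-- The rank weight of a vector: the `Fq`-dimension of the `Fq`-span of its components. -/
noncomputable def rankWeight (Fq : Type*) {K : Type*} [Field Fq] [Field K] [Algebra Fq K]
    {n : ℕ} (c : Fin n → K) : ℕ :=
  Module.finrank Fq (Submodule.span Fq (Set.range c))

/-- The operator `s_n (c_0, …, c_{n-1}) = (c_{n-1}, c_0, …, c_{n-2})`. -/
def shift {K : Type*} {n : ℕ} (c : Fin n → K) : Fin n → K :=
  fun i => c ((finRotate n).symm i)

/-- The `i`-th Frobenius operator `θ_i`, raising every component to the power `q ^ i`. -/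
def frobVec {K : Type*} [Field K] (q i : ℕ) {n : ℕ} (c : Fin n → K) : Fin n → K :=
  fun j => c j ^ q ^ i

/-- A linear code is `q^r`-cyclic if it is stable under `σ_{r,n} = θ_r ∘ s_n`. -/
def IsSkewCyclic {K : Type*} [Field K] (q r : ℕ) {n : ℕ} (C : Submodule K (Fin n → K)) : Prop :=
  ∀ c ∈ C, frobVec q r (shift c) ∈ C

/-- A linear code is Galois closed over the field with `q` elements if it is stable
under `θ_1`. -/
def IsGaloisClosed {K : Type*} [Field K] (q : ℕ) {n : ℕ} (V : Submodule K (Fin n → K)) : Prop :=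
  ∀ c ∈ V, frobVec q 1 c ∈ V

/-- Two linear codes are rank equivalent if a rank-weight-preserving vector space isomorphism
between linear Galois closed spaces containing them maps the first code onto the second. -/
def RankEquivalent (Fq : Type*) {K : Type*} [Field Fq] [Fintype Fq] [Field K] [Algebra Fq K]
    {n n' : ℕ} (C : Submodule K (Fin n → K)) (C' : Submodule K (Fin n' → K)) : Prop :=
  ∃ (V : Submodule K (Fin n → K)) (V' : Submodule K (Fin n' → K)),
    IsGaloisClosed (Fintype.card Fq) V ∧ IsGaloisClosed (Fintype.card Fq) V' ∧
    C ≤ V ∧ C' ≤ V' ∧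
    ∃ φ : V ≃ₗ[K] V',
      (∀ c : V, rankWeight Fq (φ c : Fin n' → K) = rankWeight Fq (c : Fin n → K)) ∧
      ∀ c : V, (φ c : Fin n' → K) ∈ C' ↔ (c : Fin n → K) ∈ C

/-- The rank length: the minimum `n'` such that the code is rank equivalent to a linear code
of length `n'`. -/
noncomputable def rankLength (Fq : Type*) {K : Type*} [Field Fq] [Fintype Fq] [Field K]
    [Algebra Fq K] {n : ℕ} (C : Submodule K (Fin n → K)) : ℕ :=
  sInf {n' : ℕ | ∃ C' : Submodule K (Fin n' → K), RankEquivalent Fq C C'}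

/-- The set whose minimum is the rank length contains the length of the code. -/
theorem rankLength_set_nonempty (Fq : Type*) {K : Type*} [Field Fq] [Fintype Fq] [Field K]
    [Algebra Fq K] {n : ℕ} (C : Submodule K (Fin n → K)) :
    n ∈ {n' : ℕ | ∃ C' : Submodule K (Fin n' → K), RankEquivalent Fq C C'} :=
  ⟨C, ⊤, ⊤, fun _ _ => trivial, fun _ _ => trivial, le_top, le_top,
    LinearEquiv.refl K _, fun _ => rfl, fun _ => Iff.rfl⟩

end Codes

section Linearized

variable {K : Type*} [Field K]

/-- `F` is a `q^r`-linearized polynomial `F_0 x + F_1 x^{[r]} + ⋯ + F_d x^{[dr]}`, where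
`[j] = q ^ j`; its coefficient `F_i` is `F.coeff (q ^ (r * i))`. The product of two such
polynomials is their composition `Polynomial.comp`. -/
def IsLinearized (q r : ℕ) (F : K[X]) : Prop :=
  ∀ j, F.coeff j ≠ 0 → ∃ i, j = q ^ (r * i)

/-- The `q^r`-degree: the largest `d` with `F_d ≠ 0`. -/
noncomputable def qDeg (q r : ℕ) (F : K[X]) : ℕ :=
  sSup {d : ℕ | F.coeff (q ^ (r * d)) ≠ 0}

/-- `A` divides `B` on the right in the ring of `q^r`-linearized polynomials. -/
def RightDvd (q r : ℕ) (A B : K[X]) : Prop :=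
  ∃ Q : K[X], IsLinearized q r Q ∧ B = Q.comp A

/-- `D` is the (monic) greatest common divisor on the right of the family `F`. -/
structure IsRightGcd (q r : ℕ) {ι : Type*} (F : ι → K[X]) (D : K[X]) : Prop where
  isLinearized : IsLinearized q r D
  monic : D.Monic
  dvd : ∀ i, RightDvd q r D (F i)
  greatest : ∀ D', IsLinearized q r D' → (∀ i, RightDvd q r D' (F i)) → RightDvd q r D' D

/-- `M` is the (monic) least common multiple of the family `F`, for divisibility on the right. -/
structure IsRightLcm (q r : ℕ) {ι : Type*} (F : ι → K[X]) (M : K[X]) : Prop where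
  isLinearized : IsLinearized q r M
  monic : M.Monic
  dvd : ∀ i, RightDvd q r (F i) M
  least : ∀ M', IsLinearized q r M' → (∀ i, RightDvd q r (F i) M') → RightDvd q r M M'

/-- The automorphism `θ_i`, raising every coefficient to the power `q ^ i`. -/
noncomputable def frobPoly (q i : ℕ) (F : K[X]) : K[X] :=
  F.sum fun j a => Polynomial.C (a ^ q ^ i) * X ^ j

/-- `F^⊥ = ∑_{i=0}^{d} (F_{d-i}^{[ir]} / F_0^{[dr]}) x^{[ir]}`, where `d` is the `q^r`-degree
of `F`. -/
noncomputable def perp (q r : ℕ) (F : K[X]) : K[X] :=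
  ∑ i ∈ Finset.range (qDeg q r F + 1),
    Polynomial.C (F.coeff (q ^ (r * (qDeg q r F - i))) ^ q ^ (i * r) /
      F.coeff (q ^ (r * 0)) ^ q ^ (qDeg q r F * r)) * X ^ q ^ (r * i)

/-- The polynomial `x^{[rn]} - x`. -/
noncomputable def modulus (K : Type*) [Field K] (q r n : ℕ) : K[X] :=
  X ^ q ^ (r * n) - X

/-- The polynomial `c_0 x + c_1 x^{[r]} + ⋯ + c_{n-1} x^{[(n-1)r]}` attached to a vector. -/
noncomputable def vecPoly (q r : ℕ) {n : ℕ} (c : Fin n → K) : K[X] :=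
  ∑ j : Fin n, Polynomial.C (c j) * X ^ q ^ (r * (j : ℕ))

/-- `F` is a `q^r`-linearized polynomial whose residue class modulo the left ideal generated by
`x^{[rn]} - x` is the class of a codeword of `C`. -/
def MemCode (q r : ℕ) {n : ℕ} (C : Submodule K (Fin n → K)) (F : K[X]) : Prop :=
  ∃ c ∈ C, ∃ A : K[X], IsLinearized q r A ∧ F = vecPoly q r c + A.comp (modulus K q r n)

/-- `G` is the generator polynomial of `C`: monic and of minimal `q^r`-degree among the nonzero
polynomials with residue class in `C`. -/
structure IsGeneratorPoly (q r : ℕ) {n : ℕ} (C : Submodule K (Fin n → K)) (G : K[X]) : Prop where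
  isLinearized : IsLinearized q r G
  monic : G.Monic
  mem : MemCode q r C G
  minimal : ∀ F : K[X], F ≠ 0 → MemCode q r C F → qDeg q r G ≤ qDeg q r F

/-- `H` is the check polynomial attached to the generator polynomial `G` of a code of
length `n`. -/
structure IsCheckPoly (q r n : ℕ) (G H : K[X]) : Prop where
  isLinearized : IsLinearized q r H
  gen_comp_check : G.comp H = modulus K q r n
  check_comp_gen : H.comp G = modulus K q r n

end Linearized

section RootSpaces

/-- The `E`-linear space `Z(F)` of zeroes of `F` in `L`. When `F` is `q^r`-linearized and `E` has
`q^r` elements the set of zeroes is itself a subspace, see `mem_rootSpace`. -/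
noncomputable def rootSpace (E L : Type*) {K : Type*} [Field E] [Field K] [Field L] [Algebra K L]
    [Algebra E L] (F : K[X]) : Submodule E L :=
  Submodule.span E {z : L | aeval z F = 0}

/-- The `E`-linear space `W^{[i]}` of the powers `w ^ (q ^ i)`, `w ∈ W`. When `q` is the
cardinality of a common subfield of the finite fields `E` and `L`, the set of these powers is
itself a subspace, see `mem_powSpace`. -/
noncomputable def powSpace {E L : Type*} [Field E] [Field L] [Algebra E L] (q i : ℕ)
    (W : Submodule E L) : Submodule E L :=
  Submodule.span E ((fun w : L => w ^ q ^ i) '' (W : Set L))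

theorem mem_rootSpace {E L K : Type*} [Field E] [Fintype E] [Field K] [Field L]
    [Algebra K L] [Algebra E L] {q r : ℕ} (hE : Fintype.card E = q ^ r) {F : K[X]}
    (hF : IsLinearized q r F) (z : L) : z ∈ rootSpace E L F ↔ aeval z F = 0 := by
  have key : ∀ (j : ℕ), F.coeff j ≠ 0 → ∃ φ : L →ₗ[E] L, ∀ z, φ z = z ^ j := by
    intro j hj
    obtain ⟨i, rfl⟩ := hF j hj
    refine ⟨((FiniteField.frobeniusAlgHom E L) ^ i).toLinearMap, fun z => ?_⟩
    rw [pow_mul, ← hE]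
    simp only [AlgHom.toLinearMap_apply, AlgHom.coe_pow]
    simp [FiniteField.coe_frobeniusAlgHom, pow_iterate]
  have hev : ∀ z : L, aeval z F = ∑ j ∈ F.support, algebraMap K L (F.coeff j) * z ^ j := by
    intro z
    rw [aeval_def, eval₂_eq_sum, Polynomial.sum]
  constructor
  · intro hz
    refine Submodule.span_induction (p := fun z _ => aeval z F = 0) (fun _ h => h) ?_ ?_ ?_ hz
    · rw [hev]
      refine Finset.sum_eq_zero fun j hj => ?_
      obtain ⟨φ, hφ⟩ := key j (mem_support_iff.1 hj)
      rw [← hφ, map_zero, mul_zero]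
    · intro x y _ _ hx hy
      rw [hev] at hx hy ⊢
      rw [← add_zero (0 : L), ← hx]
      nth_rewrite 2 [hx]
      rw [← hy, ← Finset.sum_add_distrib]
      refine Finset.sum_congr rfl fun j hj => ?_
      obtain ⟨φ, hφ⟩ := key j (mem_support_iff.1 hj)
      rw [← hφ, ← hφ, ← hφ, map_add, mul_add]
    · intro a x _ hx
      rw [hev] at hx ⊢
      rw [← smul_zero a, ← hx, Finset.smul_sum]
      refine Finset.sum_congr rfl fun j hj => ?_
      obtain ⟨φ, hφ⟩ := key j (mem_support_iff.1 hj)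
      rw [← hφ, ← hφ, map_smul, mul_smul_comm]
  · exact fun h => Submodule.subset_span h

theorem mem_powSpace {Fq E L : Type*} [Field Fq] [Fintype Fq] [Field E] [Finite E] [Field L]
    [Algebra Fq E] [Algebra Fq L] [Algebra E L] [IsScalarTower Fq E L] (i : ℕ)
    (W : Submodule E L) (z : L) :
    z ∈ powSpace (Fintype.card Fq) i W ↔ ∃ w ∈ W, w ^ Fintype.card Fq ^ i = z := by
  have hfrob : ∀ (A : Type _) [Field A] [Algebra Fq A] (x : A),
      ((FiniteField.frobeniusAlgHom Fq A) ^ i) x = x ^ Fintype.card Fq ^ i := by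
    intro A _ _ x
    simp only [AlgHom.coe_pow]
    simp [FiniteField.coe_frobeniusAlgHom, pow_iterate]
  have hfrobE : ∀ (x : E),
      ((FiniteField.frobeniusAlgHom Fq E) ^ i) x = x ^ Fintype.card Fq ^ i := by
    intro x
    simp only [AlgHom.coe_pow]
    simp [FiniteField.coe_frobeniusAlgHom, pow_iterate]
  constructor
  · intro hz
    refine Submodule.span_induction
      (p := fun z _ => ∃ w ∈ W, w ^ Fintype.card Fq ^ i = z) (fun _ h => h) ?_ ?_ ?_ hz
    · exact ⟨0, W.zero_mem, by rw [← hfrob, map_zero]⟩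
    · rintro _ _ _ _ ⟨x, hx, rfl⟩ ⟨y, hy, rfl⟩
      exact ⟨x + y, W.add_mem hx hy, by rw [← hfrob, ← hfrob, ← hfrob, map_add]⟩
    · rintro a _ _ ⟨x, hx, rfl⟩
      have hs : Function.Surjective ((FiniteField.frobeniusAlgHom Fq E) ^ i) :=
        Finite.surjective_of_injective (RingHom.injective
          ((FiniteField.frobeniusAlgHom Fq E) ^ i).toRingHom)
      obtain ⟨b, rfl⟩ := hs a
      refine ⟨b • x, W.smul_mem b hx, ?_⟩
      rw [hfrobE, Algebra.smul_def, Algebra.smul_def, mul_pow, map_pow]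
  · rintro ⟨w, hw, rfl⟩
    exact Submodule.subset_span ⟨w, hw, rfl⟩

end RootSpaces

end SkewCyclic

/-!
Under the identification of vectors with residue classes, a `q^r`-cyclic code is a left ideal of the
ring of linearized polynomials modulo `x^{[rn]} - x`, and right division makes its generator
polynomial `G` a generator of that ideal. The smallest Galois closed space containing the code is
again such an ideal, generated by `D = gcd(θ_i G)`, so it has dimension `n - deg D`. Galois closed
spaces have bases over `𝔽_q`; coordinates in such a basis preserve rank weights, hence the rank
length of a code is the dimension of its Galois closure.

For the zeroes, `Z(θ_i F) = Z(F)^{[i]}`, and `Z(D)` is the intersection of the `Z(θ_i G)` because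
`D` is a left combination of the `θ_i G`. A divisor `F` of `x^{[rn]} - x` has the maximal number of
zeroes, `dim Z(F) = deg F`, and is determined up to a scalar by `Z(F)`. Finally `Z(H^⊥)` is the
orthogonal of `Z(G)` for the trace form of `𝔽_{q^{rn}}` over `𝔽_{q^r}`. Passing to orthogonals turns
the intersection of the `Z(G)^{[i]}` into the sum of the `Z(H^⊥)^{[i]}`, and `gcd(θ_i G)` into
`lcm(θ_i H^⊥)`.
-/

namespace SkewCyclic

section Frobenius

theorem finite_of_finrank_pos {F V : Type*} [Field F] [Finite F] [AddCommGroup V] [Module F V]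
    (h : 0 < Module.finrank F V) : Finite V :=
  have := Module.finite_of_finrank_pos h
  Module.finite_of_finite F

/-- The `i`-th power of the Frobenius endomorphism of an algebra over a finite field. -/
noncomputable def frobeniusPow (Fq R : Type*) [Field Fq] [Fintype Fq] [CommRing R] [Algebra Fq R]
    (i : ℕ) : R →ₐ[Fq] R :=
  FiniteField.frobeniusAlgHom Fq R ^ i

variable {Fq R : Type*} [Field Fq] [Fintype Fq] [CommRing R] [Algebra Fq R]

theorem frobeniusPow_apply (i : ℕ) (x : R) :
    frobeniusPow Fq R i x = x ^ Fintype.card Fq ^ i := by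
  simp only [frobeniusPow, AlgHom.coe_pow, FiniteField.coe_frobeniusAlgHom, pow_iterate]

theorem add_pow_card_pow (i : ℕ) (x y : R) :
    (x + y) ^ Fintype.card Fq ^ i = x ^ Fintype.card Fq ^ i + y ^ Fintype.card Fq ^ i := by
  simp only [← frobeniusPow_apply, map_add]

theorem sub_pow_card_pow (i : ℕ) (x y : R) :
    (x - y) ^ Fintype.card Fq ^ i = x ^ Fintype.card Fq ^ i - y ^ Fintype.card Fq ^ i := by
  simp only [← frobeniusPow_apply, map_sub]

theorem sum_pow_card_pow {ι : Type*} (s : Finset ι) (i : ℕ) (f : ι → R) :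
    (∑ j ∈ s, f j) ^ Fintype.card Fq ^ i = ∑ j ∈ s, f j ^ Fintype.card Fq ^ i := by
  simp only [← frobeniusPow_apply, map_sum]

theorem pow_card_pow_eq_self {F : Type*} [Field F] [Algebra Fq F] [Finite F] {i : ℕ}
    (hi : Module.finrank Fq F ∣ i) (x : F) : x ^ Fintype.card Fq ^ i = x := by
  rw [← frobeniusPow_apply, frobeniusPow,
    orderOf_dvd_iff_pow_eq_one.1 ((FiniteField.orderOf_frobeniusAlgHom Fq F).symm ▸ hi),
    AlgHom.one_apply]

theorem pow_card_pow_injective {F : Type*} [Field F] [Algebra Fq F] (i : ℕ) :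
    Function.Injective fun x : F => x ^ Fintype.card Fq ^ i := by
  simp only [← frobeniusPow_apply]
  exact (frobeniusPow Fq F i : F →+* F).injective

theorem pow_card_pow_surjective {F : Type*} [Field F] [Algebra Fq F] [Finite F] (i : ℕ) :
    Function.Surjective fun x : F => x ^ Fintype.card Fq ^ i :=
  Finite.surjective_of_injective (pow_card_pow_injective i)

end Frobenius

section Linearized

variable {K : Type*} [Field K] {q r : ℕ}

theorem isLinearized_zero : IsLinearized q r (0 : K[X]) := fun _ h => (h (coeff_zero _)).elim

theorem IsLinearized.add {A B : K[X]} (hA : IsLinearized q r A) (hB : IsLinearized q r B) :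
    IsLinearized q r (A + B) := by
  intro j hj
  by_cases h : A.coeff j = 0
  · exact hB j (by simpa [h] using hj)
  · exact hA j h

theorem IsLinearized.C_mul {A : K[X]} (hA : IsLinearized q r A) (a : K) :
    IsLinearized q r (C a * A) := fun j hj =>
  hA j (right_ne_zero_of_mul (coeff_C_mul A ▸ hj))

theorem IsLinearized.sub {A B : K[X]} (hA : IsLinearized q r A) (hB : IsLinearized q r B) :
    IsLinearized q r (A - B) := by
  simpa [sub_eq_add_neg] using hA.add (hB.C_mul (-1))

theorem IsLinearized.sum {ι : Type*} {s : Finset ι} {f : ι → K[X]}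
    (h : ∀ i ∈ s, IsLinearized q r (f i)) : IsLinearized q r (∑ i ∈ s, f i) :=
  Finset.sum_induction f (IsLinearized q r) (fun _ _ => IsLinearized.add) isLinearized_zero h

theorem isLinearized_X_pow (i : ℕ) : IsLinearized q r (X ^ q ^ (r * i) : K[X]) := fun j hj =>
  ⟨i, by_contra fun h => hj (by rw [coeff_X_pow, if_neg h])⟩

theorem isLinearized_X : IsLinearized q r (X : K[X]) := by
  simpa using isLinearized_X_pow (K := K) (q := q) (r := r) 0

theorem isLinearized_C_mul_X_pow (a : K) (i : ℕ) :
    IsLinearized q r (C a * X ^ q ^ (r * i) : K[X]) :=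
  (isLinearized_X_pow i).C_mul a

theorem IsLinearized.induction {P : K[X] → Prop} {F : K[X]} (hF : IsLinearized q r F)
    (zero : P 0) (add : ∀ A B, P A → P B → P (A + B))
    (monomial : ∀ a i, P (C a * X ^ q ^ (r * i))) : P F := by
  rw [F.as_sum_support_C_mul_X_pow]
  refine Finset.sum_induction _ P add zero fun j hj => ?_
  obtain ⟨i, rfl⟩ := hF j (mem_support_iff.1 hj)
  exact monomial _ i

theorem isLinearized_modulus (n : ℕ) : IsLinearized q r (modulus K q r n) :=
  (isLinearized_X_pow n).sub isLinearized_X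

theorem isLinearized_vecPoly {n : ℕ} (c : Fin n → K) : IsLinearized q r (vecPoly q r c) :=
  IsLinearized.sum fun _ _ => isLinearized_C_mul_X_pow _ _

theorem isLinearized_perp (F : K[X]) : IsLinearized q r (perp q r F) :=
  IsLinearized.sum fun _ _ => isLinearized_C_mul_X_pow _ _

theorem q_pow_mul_injective (hq : 1 < q) (hr : 0 < r) :
    Function.Injective fun i : ℕ => q ^ (r * i) := fun _ _ h =>
  Nat.eq_of_mul_eq_mul_left hr (Nat.pow_right_injective hq h)

theorem q_pow_mul_lt_iff (hq : 1 < q) (hr : 0 < r) {i j : ℕ} :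
    q ^ (r * i) < q ^ (r * j) ↔ i < j := by
  rw [Nat.pow_lt_pow_iff_right hq, Nat.mul_lt_mul_left hr]

theorem IsLinearized.coeff_zero (hq : 1 < q) {F : K[X]} (hF : IsLinearized q r F) :
    F.coeff 0 = 0 := by
  by_contra h
  obtain ⟨d, hd⟩ := hF 0 h
  exact (pow_pos (zero_lt_one.trans hq) (r * d)).ne hd

theorem IsLinearized.natDegree_eq (hq : 1 < q) (hr : 0 < r) {F : K[X]}
    (hF : IsLinearized q r F) (h0 : F ≠ 0) : F.natDegree = q ^ (r * qDeg q r F) := by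
  obtain ⟨d, hd⟩ := hF F.natDegree (leadingCoeff_ne_zero.2 h0)
  suffices h : IsGreatest {e : ℕ | F.coeff (q ^ (r * e)) ≠ 0} d by rw [qDeg, h.csSup_eq, hd]
  have hlc : F.coeff (q ^ (r * d)) ≠ 0 := hd ▸ leadingCoeff_ne_zero.2 h0
  refine ⟨hlc, fun e he => not_lt.1 fun h => ?_⟩
  exact (hd ▸ le_natDegree_of_ne_zero he).not_gt ((q_pow_mul_lt_iff hq hr).2 h)

theorem IsLinearized.qDeg_eq_of_natDegree_eq (hq : 1 < q) (hr : 0 < r) {F : K[X]}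
    (hF : IsLinearized q r F) {d : ℕ} (h : F.natDegree = q ^ (r * d)) : qDeg q r F = d := by
  have h0 : F ≠ 0 := by
    rintro rfl
    exact (pow_pos (zero_lt_one.trans hq) (r * d)).ne (natDegree_zero.symm.trans h)
  exact q_pow_mul_injective hq hr ((hF.natDegree_eq hq hr h0).symm.trans h)

theorem IsLinearized.degree_eq (hq : 1 < q) (hr : 0 < r) {F : K[X]}
    (hF : IsLinearized q r F) (h0 : F ≠ 0) : F.degree = (q ^ (r * qDeg q r F) : ℕ) := by
  rw [degree_eq_natDegree h0, hF.natDegree_eq hq hr h0]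

theorem IsLinearized.degree_lt_iff (hq : 1 < q) (hr : 0 < r) {F : K[X]}
    (hF : IsLinearized q r F) (h0 : F ≠ 0) {d : ℕ} :
    F.degree < (q ^ (r * d) : ℕ) ↔ qDeg q r F < d := by
  rw [hF.degree_eq hq hr h0, Nat.cast_lt, q_pow_mul_lt_iff hq hr]

theorem IsLinearized.eq_sum (hq : 1 < q) (hr : 0 < r) {F : K[X]} (hF : IsLinearized q r F)
    {d : ℕ} (hd : F.degree < (q ^ (r * d) : ℕ)) :
    F = ∑ i ∈ Finset.range d, C (F.coeff (q ^ (r * i))) * X ^ q ^ (r * i) := by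
  ext j
  simp only [finsetSum_coeff, coeff_C_mul, coeff_X_pow, mul_ite, mul_one, mul_zero]
  by_cases hj : ∃ i, j = q ^ (r * i)
  · obtain ⟨i, rfl⟩ := hj
    simp only [(q_pow_mul_injective hq hr).eq_iff, Finset.sum_ite_eq, Finset.mem_range]
    split_ifs with h
    · rfl
    · refine coeff_eq_zero_of_degree_lt (hd.trans_le ?_)
      exact_mod_cast not_lt.1 (mt (q_pow_mul_lt_iff hq hr).1 h)
  · rw [Finset.sum_eq_zero fun i _ => if_neg fun h => hj ⟨i, h⟩]
    exact by_contra fun h => hj (hF j h)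

theorem IsLinearized.comp_eq_zero_iff (hq : 1 < q) {D : K[X]} (hD : IsLinearized q r D)
    (hD0 : D ≠ 0) {F : K[X]} : F.comp D = 0 ↔ F = 0 := by
  rw [Polynomial.comp_eq_zero_iff, hD.coeff_zero hq, C_0, or_iff_left fun h => hD0 h.2]

theorem natDegree_modulus (hq : 1 < q) (hr : 0 < r) {n : ℕ} (hn : 0 < n) :
    (modulus K q r n).natDegree = q ^ (r * n) :=
  FiniteField.X_pow_card_sub_X_natDegree_eq K (Nat.one_lt_pow (by positivity) hq)

theorem modulus_ne_zero (hq : 1 < q) (hr : 0 < r) {n : ℕ} (hn : 0 < n) :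
    modulus K q r n ≠ 0 :=
  FiniteField.X_pow_card_sub_X_ne_zero K (Nat.one_lt_pow (by positivity) hq)

theorem qDeg_modulus (hq : 1 < q) (hr : 0 < r) {n : ℕ} (hn : 0 < n) :
    qDeg q r (modulus K q r n) = n :=
  (isLinearized_modulus n).qDeg_eq_of_natDegree_eq hq hr (natDegree_modulus hq hr hn)

end Linearized

section RightDivisibility

variable {K : Type*} [Field K] {q r : ℕ}

theorem RightDvd.dvd (hq : 1 < q) {A B : K[X]} (h : RightDvd q r A B) : A ∣ B := by
  obtain ⟨Q, hQ, rfl⟩ := h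
  obtain ⟨Q', rfl⟩ := X_dvd_iff.2 (hQ.coeff_zero hq)
  simp only [mul_comp, X_comp, dvd_mul_right]

theorem RightDvd.qDeg_le (hq : 1 < q) (hr : 0 < r) {A B : K[X]} (hA : IsLinearized q r A)
    (hB : IsLinearized q r B) (hB0 : B ≠ 0) (h : RightDvd q r A B) : qDeg q r A ≤ qDeg q r B := by
  have hle := natDegree_le_of_dvd (h.dvd hq) hB0
  rw [hA.natDegree_eq hq hr (ne_zero_of_dvd_ne_zero hB0 (h.dvd hq)),
    hB.natDegree_eq hq hr hB0] at hle
  exact not_lt.1 fun hlt => hle.not_gt ((q_pow_mul_lt_iff hq hr).2 hlt)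

theorem RightDvd.antisymm_of_monic (hq : 1 < q) {A B : K[X]} (hA : A.Monic) (hB : B.Monic)
    (hAB : RightDvd q r A B) (hBA : RightDvd q r B A) : A = B :=
  eq_of_monic_of_associated hA hB (associated_of_dvd_dvd (hAB.dvd hq) (hBA.dvd hq))

theorem IsRightGcd.unique (hq : 1 < q) {ι : Type*} {F : ι → K[X]} {D D' : K[X]}
    (hD : IsRightGcd q r F D) (hD' : IsRightGcd q r F D') : D = D' :=
  RightDvd.antisymm_of_monic hq hD.monic hD'.monic
    (hD'.greatest D hD.isLinearized hD.dvd) (hD.greatest D' hD'.isLinearized hD'.dvd)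

theorem IsRightLcm.unique (hq : 1 < q) {ι : Type*} {F : ι → K[X]} {M M' : K[X]}
    (hM : IsRightLcm q r F M) (hM' : IsRightLcm q r F M') : M = M' :=
  RightDvd.antisymm_of_monic hq hM.monic hM'.monic
    (hM.least M' hM'.isLinearized hM'.dvd) (hM'.least M hM.isLinearized hM.dvd)

/-- The space of left multiples of `D`, the principal left ideal generated by `D` in the ring
of linearized polynomials. -/
def leftMultiples (q r : ℕ) (D : K[X]) : Submodule K K[X] where
  carrier := {F | RightDvd q r D F}
  add_mem' := by
    rintro _ _ ⟨P, hP, rfl⟩ ⟨Q, hQ, rfl⟩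
    exact ⟨P + Q, hP.add hQ, add_comp.symm⟩
  zero_mem' := ⟨0, isLinearized_zero, zero_comp.symm⟩
  smul_mem' := by
    rintro a _ ⟨Q, hQ, rfl⟩
    exact ⟨C a * Q, hQ.C_mul a, by rw [C_mul_comp, smul_eq_C_mul]⟩

theorem mem_leftMultiples {D F : K[X]} : F ∈ leftMultiples q r D ↔ RightDvd q r D F :=
  Iff.rfl

theorem RightDvd.refl (A : K[X]) : RightDvd q r A A := ⟨X, isLinearized_X, X_comp.symm⟩

/-- `S` is a left ideal of the ring of linearized polynomials. -/
structure IsLeftIdeal (q r : ℕ) (S : Submodule K K[X]) : Prop where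
  isLinearized : ∀ F ∈ S, IsLinearized q r F
  comp_mem : ∀ Q, IsLinearized q r Q → ∀ F ∈ S, Q.comp F ∈ S

theorem isLeftIdeal_of_pow_mem {S : Submodule K K[X]} (hS : ∀ F ∈ S, IsLinearized q r F)
    (hpow : ∀ F ∈ S, F ^ q ^ r ∈ S) : IsLeftIdeal q r S := by
  refine ⟨hS, fun Q hQ F hF => hQ.induction (P := fun Q => Q.comp F ∈ S) ?_ ?_ ?_⟩
  · simp only [zero_comp, S.zero_mem]
  · intro A B hA hB
    simpa only [add_comp] using S.add_mem hA hB
  · intro a i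
    have hFi : F ^ q ^ (r * i) ∈ S := by
      induction i with
      | zero => simpa using hF
      | succ i ih => simpa only [← pow_mul, ← pow_add, ← mul_add_one] using hpow _ ih
    simpa [← smul_eq_C_mul] using S.smul_mem a hFi

theorem IsLeftIdeal.pow_mem {S : Submodule K K[X]} (hS : IsLeftIdeal q r S) {F : K[X]}
    (hF : F ∈ S) (j : ℕ) : F ^ q ^ (r * j) ∈ S := by
  simpa only [X_pow_comp] using hS.comp_mem _ (isLinearized_X_pow j) F hF

theorem IsLeftIdeal.leftMultiples_le {S : Submodule K K[X]} (hS : IsLeftIdeal q r S) {D : K[X]}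
    (hD : D ∈ S) : leftMultiples q r D ≤ S := by
  rintro _ ⟨Q, hQ, rfl⟩
  exact hS.comp_mem Q hQ D hD

theorem exists_degree_sub_comp_lt (hq : 1 < q) (hr : 0 < r) {A B : K[X]} (hA : IsLinearized q r A)
    (hB : IsLinearized q r B) (hA0 : A ≠ 0) (hB0 : B ≠ 0) (hAB : A.degree ≤ B.degree) :
    ∃ Q, IsLinearized q r Q ∧ (B - Q.comp A).degree < B.degree := by
  obtain ⟨e, he⟩ : ∃ e, qDeg q r B = qDeg q r A + e := by
    refine Nat.exists_eq_add_of_le (not_lt.1 fun h => hAB.not_gt ?_)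
    rwa [hA.degree_eq hq hr hA0, hB.degree_lt_iff hq hr hB0]
  have hlc : A.leadingCoeff ^ q ^ (r * e) ≠ 0 := pow_ne_zero _ (leadingCoeff_ne_zero.2 hA0)
  set a := B.leadingCoeff / A.leadingCoeff ^ q ^ (r * e) with ha
  have ha0 : C a ≠ 0 := C_ne_zero.2 (div_ne_zero (leadingCoeff_ne_zero.2 hB0) hlc)
  refine ⟨C a * X ^ q ^ (r * e), isLinearized_C_mul_X_pow _ _, ?_⟩
  rw [C_mul_comp, X_pow_comp]
  have hne : C a * A ^ q ^ (r * e) ≠ 0 := mul_ne_zero ha0 (pow_ne_zero _ hA0)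
  refine degree_sub_lt_left ?_ hB0 ?_
  · rw [degree_eq_natDegree hB0, degree_eq_natDegree hne, natDegree_C_mul (C_ne_zero.1 ha0),
      natDegree_pow, hA.natDegree_eq hq hr hA0, hB.natDegree_eq hq hr hB0, he, ← pow_add,
      ← mul_add, add_comm e]
  · rw [leadingCoeff_mul, leadingCoeff_C, leadingCoeff_pow, ha, div_mul_cancel₀ _ hlc]

end RightDivisibility

section Composition

variable {Fq K : Type*} [Field Fq] [Fintype Fq] [Field K] [Algebra Fq K] {r : ℕ}

local notation "𝐪" => Fintype.card Fq

theorem IsLinearized.pow {F : K[X]} (hF : IsLinearized 𝐪 r F) (i : ℕ) :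
    IsLinearized 𝐪 r (F ^ 𝐪 ^ (r * i)) := by
  refine hF.induction (P := fun F => IsLinearized 𝐪 r (F ^ 𝐪 ^ (r * i))) ?_ ?_ ?_
  · rw [zero_pow (pow_pos Fintype.card_pos _).ne']
    exact isLinearized_zero
  · intro A B hA hB
    rw [add_pow_card_pow]
    exact hA.add hB
  · intro a j
    rw [mul_pow, ← pow_mul, ← pow_add, ← C_pow, ← mul_add]
    exact isLinearized_C_mul_X_pow _ _

theorem IsLinearized.comp {A B : K[X]} (hA : IsLinearized 𝐪 r A) (hB : IsLinearized 𝐪 r B) :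
    IsLinearized 𝐪 r (A.comp B) := by
  refine hA.induction (P := fun A => IsLinearized 𝐪 r (A.comp B)) ?_ ?_ ?_
  · simpa only [zero_comp] using isLinearized_zero
  · intro A A' hA hA'
    simpa only [add_comp] using hA.add hA'
  · intro a i
    simpa only [C_mul_comp, X_pow_comp] using (hB.pow i).C_mul a

theorem qDeg_comp (hr : 0 < r) {A B : K[X]} (hA : IsLinearized 𝐪 r A) (hB : IsLinearized 𝐪 r B)
    (hA0 : A ≠ 0) (hB0 : B ≠ 0) : qDeg 𝐪 r (A.comp B) = qDeg 𝐪 r A + qDeg 𝐪 r B := by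
  have hq : 1 < 𝐪 := Fintype.one_lt_card
  apply (hA.comp hB).qDeg_eq_of_natDegree_eq hq hr
  rw [natDegree_comp, hA.natDegree_eq hq hr hA0, hB.natDegree_eq hq hr hB0, ← pow_add, ← mul_add]

theorem RightDvd.trans {A B D : K[X]} (hAB : RightDvd 𝐪 r A B) (hBD : RightDvd 𝐪 r B D) :
    RightDvd 𝐪 r A D := by
  obtain ⟨P, hP, rfl⟩ := hAB
  obtain ⟨Q, hQ, rfl⟩ := hBD
  exact ⟨Q.comp P, hQ.comp hP, (comp_assoc _ _ _).symm⟩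

theorem isLeftIdeal_leftMultiples {D : K[X]} (hD : IsLinearized 𝐪 r D) :
    IsLeftIdeal 𝐪 r (leftMultiples 𝐪 r D) where
  isLinearized := by
    rintro _ ⟨Q, hQ, rfl⟩
    exact hQ.comp hD
  comp_mem P hP _ hF := hF.trans ⟨P, hP, rfl⟩

theorem exists_degree_sub_comp_lt_divisor (hr : 0 < r) {A B : K[X]} (hA : IsLinearized 𝐪 r A)
    (hB : IsLinearized 𝐪 r B) (hA0 : A ≠ 0) :
    ∃ Q, IsLinearized 𝐪 r Q ∧ (B - Q.comp A).degree < A.degree := by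
  induction hd : B.degree using WellFoundedLT.induction generalizing B with
  | _ d ih =>
  subst hd
  by_cases hlt : B.degree < A.degree
  · exact ⟨0, isLinearized_zero, by simpa only [zero_comp, sub_zero] using hlt⟩
  have hB0 : B ≠ 0 := by
    rintro rfl
    exact hlt (by rwa [degree_zero, bot_lt_iff_ne_bot, degree_ne_bot])
  obtain ⟨P, hP, hPlt⟩ :=
    exists_degree_sub_comp_lt Fintype.one_lt_card hr hA hB hA0 hB0 (not_lt.1 hlt)
  obtain ⟨Q, hQ, hQlt⟩ := ih _ hPlt (hB.sub (hP.comp hA)) rfl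
  exact ⟨P + Q, hP.add hQ, by rwa [add_comp, ← sub_sub]⟩

theorem IsLeftIdeal.rightDvd_of_minimal (hr : 0 < r) {S : Submodule K K[X]}
    (hS : IsLeftIdeal 𝐪 r S) {D : K[X]} (hD : D ∈ S) (hD0 : D ≠ 0)
    (hmin : ∀ F ∈ S, F ≠ 0 → qDeg 𝐪 r D ≤ qDeg 𝐪 r F) {F : K[X]} (hF : F ∈ S) :
    RightDvd 𝐪 r D F := by
  have hDl := hS.isLinearized D hD
  obtain ⟨Q, hQ, hlt⟩ :=
    exists_degree_sub_comp_lt_divisor hr hDl (hS.isLinearized F hF) hD0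
  have hR : F - Q.comp D ∈ S := S.sub_mem hF (hS.comp_mem Q hQ D hD)
  refine ⟨Q, hQ, sub_eq_zero.1 (by_contra fun hR0 => (hmin _ hR hR0).not_gt ?_)⟩
  rwa [hDl.degree_eq Fintype.one_lt_card hr hD0,
    (hS.isLinearized _ hR).degree_lt_iff Fintype.one_lt_card hr hR0] at hlt

theorem IsLeftIdeal.exists_monic_generator (hr : 0 < r) {S : Submodule K K[X]}
    (hS : IsLeftIdeal 𝐪 r S) (h0 : ∃ F ∈ S, F ≠ 0) :
    ∃ D ∈ S, D.Monic ∧ ∀ F ∈ S, RightDvd 𝐪 r D F := by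
  obtain ⟨F, ⟨hF, hF0⟩, hmin⟩ :=
    exists_minimalFor_of_wellFoundedLT (fun F => F ∈ S ∧ F ≠ 0) (qDeg 𝐪 r) h0
  have hlc := leadingCoeff_ne_zero.2 hF0
  refine ⟨C F.leadingCoeff⁻¹ * F, ?_, ?_, fun B hB => ?_⟩
  · exact smul_eq_C_mul (R := K) F.leadingCoeff⁻¹ ▸ S.smul_mem _ hF
  · rw [Monic, leadingCoeff_mul, leadingCoeff_C, inv_mul_cancel₀ hlc]
  · have hFdvd : RightDvd 𝐪 r F B := hS.rightDvd_of_minimal hr hF hF0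
      (fun A hA hA0 => (le_total _ _).elim id fun h => hmin ⟨hA, hA0⟩ h) hB
    refine RightDvd.trans ⟨C F.leadingCoeff * X, isLinearized_X.C_mul _, ?_⟩ hFdvd
    rw [C_mul_comp, X_comp, ← mul_assoc, ← C_mul, mul_inv_cancel₀ hlc, C_1, one_mul]

/-- The left ideal generated by the set `T` of linearized polynomials, written as the `K`-span
of the compositions `x^{[rj]} ⊗ A`, `A ∈ T`. -/
noncomputable def leftSpan (q r : ℕ) (T : Set K[X]) : Submodule K K[X] :=
  Submodule.span K {B | ∃ A ∈ T, ∃ j : ℕ, B = A ^ q ^ (r * j)}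

theorem subset_leftSpan {q : ℕ} (T : Set K[X]) : T ⊆ leftSpan q r T := fun A hA =>
  Submodule.subset_span ⟨A, hA, 0, by rw [mul_zero, pow_zero, pow_one]⟩

theorem IsLeftIdeal.leftSpan_le {q : ℕ} {S : Submodule K K[X]} (hS : IsLeftIdeal q r S)
    {T : Set K[X]} (hT : T ⊆ S) : leftSpan q r T ≤ S := by
  refine Submodule.span_le.2 ?_
  rintro _ ⟨A, hA, j, rfl⟩
  exact hS.pow_mem (hT hA) j

theorem isLeftIdeal_leftSpan {T : Set K[X]} (hT : ∀ A ∈ T, IsLinearized 𝐪 r A) :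
    IsLeftIdeal 𝐪 r (leftSpan 𝐪 r T) := by
  refine isLeftIdeal_of_pow_mem (fun F hF => ?_) (fun F hF => ?_) <;> rw [leftSpan] at hF
  · induction hF using Submodule.span_induction with
    | mem F hF =>
      obtain ⟨A, hA, j, rfl⟩ := hF
      exact (hT A hA).pow j
    | zero => exact isLinearized_zero
    | add F F' _ _ h h' => exact h.add h'
    | smul a F _ h => exact smul_eq_C_mul (R := K) a ▸ h.C_mul a
  · induction hF using Submodule.span_induction with
    | mem F hF =>
      obtain ⟨A, hA, j, rfl⟩ := hF
      refine Submodule.subset_span ⟨A, hA, j + 1, ?_⟩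
      rw [← pow_mul, ← pow_add, mul_add_one]
    | zero => simp
    | add F F' _ _ h h' => exact add_pow_card_pow (Fq := Fq) r F F' ▸ Submodule.add_mem _ h h'
    | smul a F _ h => exact smul_pow a F _ ▸ Submodule.smul_mem _ _ h

theorem exists_isRightGcd_mem_leftSpan (hr : 0 < r) {ι : Type*} {F : ι → K[X]}
    (hF : ∀ i, IsLinearized 𝐪 r (F i)) (h0 : ∃ i, F i ≠ 0) :
    ∃ D ∈ leftSpan 𝐪 r (Set.range F), IsRightGcd 𝐪 r F D := by
  have hS := isLeftIdeal_leftSpan (Set.forall_mem_range.2 hF)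
  have hFS : ∀ i, F i ∈ leftSpan 𝐪 r (Set.range F) := fun i => subset_leftSpan _ ⟨i, rfl⟩
  obtain ⟨i, hi⟩ := h0
  obtain ⟨D, hD, hmonic, hdvd⟩ := hS.exists_monic_generator hr ⟨F i, hFS i, hi⟩
  refine ⟨D, hD, hS.isLinearized D hD, hmonic, fun i => hdvd _ (hFS i), fun D' hD' hD'F => ?_⟩
  exact (isLeftIdeal_leftMultiples hD').leftSpan_le (Set.range_subset_iff.2 hD'F) hD

theorem IsRightGcd.mem_leftSpan (hr : 0 < r) {ι : Type*} {F : ι → K[X]} {D : K[X]}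
    (hD : IsRightGcd 𝐪 r F D) (hF : ∀ i, IsLinearized 𝐪 r (F i)) (h0 : ∃ i, F i ≠ 0) :
    D ∈ leftSpan 𝐪 r (Set.range F) := by
  obtain ⟨D', hD'mem, hD'⟩ := exists_isRightGcd_mem_leftSpan hr hF h0
  exact hD.unique Fintype.one_lt_card hD' ▸ hD'mem

end Composition

section RankLength

variable {K : Type*} [Field K] {n : ℕ}

theorem IsGaloisClosed.frobVec_mem {q : ℕ} {V : Submodule K (Fin n → K)} (hV : IsGaloisClosed q V)
    (i : ℕ) {c : Fin n → K} (hc : c ∈ V) : frobVec q i c ∈ V := by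
  induction i with
  | zero => simpa +unfoldPartialApp only [frobVec, pow_zero, pow_one] using hc
  | succ i ih =>
    simpa +unfoldPartialApp only [frobVec, pow_one, ← pow_mul, ← pow_succ] using hV _ ih

variable {Fq : Type*} [Field Fq] [Algebra Fq K]

theorem rankWeight_vecMul_le {k l : ℕ} (x : Fin k → K) (B : Matrix (Fin k) (Fin l) Fq) :
    rankWeight Fq (Matrix.vecMul x (B.map (algebraMap Fq K))) ≤ rankWeight Fq x := by
  have : FiniteDimensional Fq (Submodule.span Fq (Set.range x)) :=
    FiniteDimensional.span_of_finite Fq (Set.finite_range x)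
  refine Submodule.finrank_mono (Submodule.span_le.2 ?_)
  rintro _ ⟨j, rfl⟩
  simp only [Matrix.vecMul, dotProduct, Matrix.map_apply]
  refine Submodule.sum_mem _ fun i _ => ?_
  rw [mul_comm, ← Algebra.smul_def]
  exact Submodule.smul_mem _ _ (Submodule.subset_span ⟨i, rfl⟩)

theorem vecMul_map_vecMul_map_of_mul_eq_one {k l : ℕ} {B : Matrix (Fin k) (Fin l) Fq}
    {P : Matrix (Fin l) (Fin k) Fq} (hBP : B * P = 1) (x : Fin k → K) :
    Matrix.vecMul (Matrix.vecMul x (B.map (algebraMap Fq K))) (P.map (algebraMap Fq K)) = x := by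
  rw [Matrix.vecMul_vecMul, ← Matrix.map_mul, hBP, Matrix.map_one _ (map_zero _) (map_one _),
    Matrix.vecMul_one]

theorem rankWeight_vecMul_of_mul_eq_one {k l : ℕ} {B : Matrix (Fin k) (Fin l) Fq}
    {P : Matrix (Fin l) (Fin k) Fq} (hBP : B * P = 1) (x : Fin k → K) :
    rankWeight Fq (Matrix.vecMul x (B.map (algebraMap Fq K))) = rankWeight Fq x := by
  refine le_antisymm (rankWeight_vecMul_le x B) ?_
  simpa only [vecMul_map_vecMul_map_of_mul_eq_one hBP] using
    rankWeight_vecMul_le (Matrix.vecMul x (B.map (algebraMap Fq K))) P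

/-- The coordinatewise inclusion of vectors over the base field. -/
noncomputable def vecInclusion (Fq K : Type*) [Field Fq] [Field K] [Algebra Fq K] (n : ℕ) :
    (Fin n → Fq) →ₗ[Fq] (Fin n → K) :=
  (Algebra.linearMap Fq K).compLeft (Fin n)

/-- The subfield subcode of `V`: its codewords with components in the base field. -/
noncomputable def subfieldSubcode (Fq : Type*) [Field Fq] [Algebra Fq K]
    (V : Submodule K (Fin n → K)) : Submodule Fq (Fin n → Fq) :=
  (V.restrictScalars Fq).comap (vecInclusion Fq K n)

theorem exists_mul_eq_one_of_linearIndependent_row {k l : ℕ} {B : Matrix (Fin k) (Fin l) Fq}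
    (hB : LinearIndependent Fq B.row) :
    ∃ P : Matrix (Fin l) (Fin k) Fq, B * P = 1 := by
  have hker : LinearMap.ker B.vecMulLinear = ⊥ :=
    LinearMap.ker_eq_bot.2 (Matrix.vecMul_injective_iff.2 hB)
  obtain ⟨f, hf⟩ := LinearMap.exists_leftInverse_of_injective _ hker
  refine ⟨LinearMap.toMatrixRight' f, Matrix.toLinearMapRight'.injective ?_⟩
  rw [Matrix.toLinearMapRight'_mul, Matrix.toLinearMapRight'_one, ← hf]
  exact congrArg (· ∘ₗ B.vecMulLinear) (LinearMap.toMatrixRight'.symm_apply_apply f)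

variable [Fintype Fq]

local notation "𝐪" => Fintype.card Fq

theorem trace_mem_subfieldSubcode [Finite K] {V : Submodule K (Fin n → K)}
    (hV : IsGaloisClosed 𝐪 V) {c : Fin n → K} (hc : c ∈ V) :
    (fun j => Algebra.trace Fq K (c j)) ∈ subfieldSubcode Fq V := by
  have htrace : vecInclusion Fq K n (fun j => Algebra.trace Fq K (c j)) =
      ∑ i ∈ Finset.range (Module.finrank Fq K), frobVec 𝐪 i c := by
    ext j
    rw [Finset.sum_apply, vecInclusion, LinearMap.compLeft_apply, Function.comp_apply,
      Algebra.linearMap_apply, FiniteField.algebraMap_trace_eq_sum_pow, Nat.card_eq_fintype_card]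
    rfl
  change vecInclusion Fq K n _ ∈ V
  exact htrace ▸ V.sum_mem fun i _ => hV.frobVec_mem i hc

theorem IsGaloisClosed.eq_span_subfieldSubcode [Finite K] {V : Submodule K (Fin n → K)}
    (hV : IsGaloisClosed 𝐪 V) :
    V = Submodule.span K ((subfieldSubcode Fq V).map (vecInclusion Fq K n)) := by
  classical
  have : FiniteDimensional Fq K := Module.Finite.of_finite
  refine le_antisymm (fun c hc => ?_) (Submodule.span_le.2 ?_)
  · let b := Module.finBasis Fq K
    have hc_eq : c = ∑ i, b.traceDual i • vecInclusion Fq K n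
        fun j => Algebra.trace Fq K ((b i • c) j) := by
      ext j
      conv_lhs => rw [← b.traceDual.sum_repr (c j)]
      simp only [Finset.sum_apply, Pi.smul_apply, smul_eq_mul]
      refine Finset.sum_congr rfl fun i _ => ?_
      rw [Module.Basis.traceDual_repr_apply, Algebra.smul_def, mul_comm,
        Algebra.traceForm_apply, mul_comm (c j)]
      rfl
    rw [hc_eq]
    refine Submodule.sum_mem _ fun i _ => Submodule.smul_mem _ _ (Submodule.subset_span ?_)
    exact Submodule.mem_map_of_mem (trace_mem_subfieldSubcode hV (V.smul_mem _ hc))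
  · rintro _ ⟨v, hv, rfl⟩
    exact hv

theorem IsGaloisClosed.exists_eq_range_vecMulLinear [Finite K] {V : Submodule K (Fin n → K)}
    (hV : IsGaloisClosed 𝐪 V) :
    ∃ (k : ℕ) (B : Matrix (Fin k) (Fin n) Fq) (P : Matrix (Fin n) (Fin k) Fq), B * P = 1 ∧
      V = LinearMap.range (B.map (algebraMap Fq K)).vecMulLinear := by
  let b := Module.finBasis Fq (subfieldSubcode Fq V)
  let B : Matrix (Fin (Module.finrank Fq (subfieldSubcode Fq V))) (Fin n) Fq :=
    Matrix.of fun i => (b i : Fin n → Fq)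
  have hli : LinearIndependent Fq B.row :=
    b.linearIndependent.map' (subfieldSubcode Fq V).subtype (Submodule.ker_subtype _)
  obtain ⟨P, hP⟩ := exists_mul_eq_one_of_linearIndependent_row hli
  refine ⟨_, B, P, hP, ?_⟩
  have hspan : subfieldSubcode Fq V = Submodule.span Fq (Set.range B.row) := by
    have := congrArg (Submodule.map (subfieldSubcode Fq V).subtype) b.span_eq
    rwa [Submodule.map_span, Submodule.map_subtype_top, ← Set.range_comp, eq_comm] at this
  calc V = Submodule.span K ((subfieldSubcode Fq V).map (vecInclusion Fq K n)) :=
        hV.eq_span_subfieldSubcode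
    _ = Submodule.span K ((Submodule.span Fq (Set.range B.row)).map (vecInclusion Fq K n)) :=
        congrArg (fun S => Submodule.span K (S.map (vecInclusion Fq K n) : Set (Fin n → K))) hspan
    _ = Submodule.span K (vecInclusion Fq K n '' Set.range B.row) := by
        rw [Submodule.map_span, Submodule.span_span_of_tower]
    _ = LinearMap.range (B.map (algebraMap Fq K)).vecMulLinear := by
        rw [range_vecMulLinear, ← Set.range_comp]
        rfl

theorem IsGaloisClosed.exists_rankEquivalent [Finite K] {C V : Submodule K (Fin n → K)}
    (hV : IsGaloisClosed 𝐪 V) (hCV : C ≤ V) :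
    ∃ C' : Submodule K (Fin (Module.finrank K V) → K), RankEquivalent Fq C C' := by
  obtain ⟨k, B, P, hBP, hVB⟩ := hV.exists_eq_range_vecMulLinear
  have hinj : Function.Injective (B.map (algebraMap Fq K)).vecMulLinear :=
    Function.LeftInverse.injective
      (g := (P.map (algebraMap Fq K)).vecMulLinear) (vecMul_map_vecMul_map_of_mul_eq_one hBP)
  let e : (Fin k → K) ≃ₗ[K] V :=
    (LinearEquiv.ofInjective _ hinj).trans (LinearEquiv.ofEq _ _ hVB.symm)
  rw [← e.finrank_eq, Module.finrank_fin_fun]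
  refine ⟨C.comap (V.subtype ∘ₗ e.toLinearMap), V, ⊤, hV, fun _ _ => trivial, hCV, le_top,
    e.symm.trans (LinearEquiv.ofTop ⊤ rfl).symm, fun c => ?_, fun c => ?_⟩
  · obtain ⟨x, rfl⟩ := e.surjective c
    rw [LinearEquiv.trans_apply, e.symm_apply_apply]
    exact (rankWeight_vecMul_of_mul_eq_one hBP x).symm
  · obtain ⟨x, rfl⟩ := e.surjective c
    rw [LinearEquiv.trans_apply, e.symm_apply_apply]
    rfl

theorem rankLength_eq_finrank [Finite K] {C V : Submodule K (Fin n → K)}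
    (hV : IsGaloisClosed 𝐪 V) (hCV : C ≤ V)
    (hmin : ∀ V', IsGaloisClosed 𝐪 V' → C ≤ V' → V ≤ V') :
    rankLength Fq C = Module.finrank K V := by
  refine IsLeast.csInf_eq ⟨hV.exists_rankEquivalent hCV, ?_⟩
  rintro k ⟨C', W, W', hW, -, hCW, -, φ, -⟩
  calc Module.finrank K V ≤ Module.finrank K W := Submodule.finrank_mono (hmin W hW hCW)
    _ = Module.finrank K W' := φ.finrank_eq
    _ ≤ Module.finrank K (Fin k → K) := Submodule.finrank_le _
    _ = k := Module.finrank_fin_fun K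

end RankLength

section FrobPoly

variable {Fq K : Type*} [Field Fq] [Fintype Fq] [Field K] [Algebra Fq K] {r : ℕ}

local notation "𝐪" => Fintype.card Fq

theorem frobPoly_eq_map (i : ℕ) (F : K[X]) :
    frobPoly 𝐪 i F = F.map (frobeniusPow Fq K i : K →+* K) := by
  rw [frobPoly, Polynomial.map, eval₂_eq_sum]
  simp only [RingHom.comp_apply, RingHom.coe_coe, frobeniusPow_apply]

theorem coeff_frobPoly (i : ℕ) (F : K[X]) (j : ℕ) :
    (frobPoly 𝐪 i F).coeff j = F.coeff j ^ 𝐪 ^ i := by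
  rw [frobPoly_eq_map, coeff_map, RingHom.coe_coe, frobeniusPow_apply]

theorem frobPoly_zero (F : K[X]) : frobPoly 𝐪 0 F = F := by
  ext j
  rw [coeff_frobPoly, pow_zero, pow_one]

theorem frobPoly_frobPoly (i j : ℕ) (F : K[X]) :
    frobPoly 𝐪 i (frobPoly 𝐪 j F) = frobPoly 𝐪 (j + i) F := by
  ext k
  simp only [coeff_frobPoly, ← pow_mul, pow_add]

theorem frobPoly_mod_finrank [Finite K] (i : ℕ) (F : K[X]) :
    frobPoly 𝐪 (i % Module.finrank Fq K) F = frobPoly 𝐪 i F := by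
  rw [frobPoly_eq_map, frobPoly_eq_map, frobeniusPow, frobeniusPow,
    ← FiniteField.orderOf_frobeniusAlgHom, pow_mod_orderOf]

theorem frobPoly_comp (i : ℕ) (A B : K[X]) :
    frobPoly 𝐪 i (A.comp B) = (frobPoly 𝐪 i A).comp (frobPoly 𝐪 i B) := by
  simp only [frobPoly_eq_map, Polynomial.map_comp]

theorem frobPoly_add (i : ℕ) (A B : K[X]) :
    frobPoly 𝐪 i (A + B) = frobPoly 𝐪 i A + frobPoly 𝐪 i B := by
  simp only [frobPoly_eq_map, Polynomial.map_add]

theorem frobPoly_pow (i : ℕ) (A : K[X]) (k : ℕ) :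
    frobPoly 𝐪 i (A ^ k) = frobPoly 𝐪 i A ^ k := by
  simp only [frobPoly_eq_map, Polynomial.map_pow]

theorem frobPoly_modulus (i n : ℕ) :
    frobPoly 𝐪 i (modulus K 𝐪 r n) = modulus K 𝐪 r n := by
  simp only [frobPoly_eq_map, modulus, Polynomial.map_sub, Polynomial.map_pow, map_X]

theorem frobPoly_vecPoly (i : ℕ) {n : ℕ} (c : Fin n → K) :
    frobPoly 𝐪 i (vecPoly 𝐪 r c) = vecPoly 𝐪 r (frobVec 𝐪 i c) := by
  simp only [frobPoly_eq_map, vecPoly, frobVec, Polynomial.map_sum, Polynomial.map_mul, map_C,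
    Polynomial.map_pow, map_X, RingHom.coe_coe, frobeniusPow_apply]

theorem IsLinearized.frobPoly {F : K[X]} (hF : IsLinearized 𝐪 r F) (i : ℕ) :
    IsLinearized 𝐪 r (frobPoly 𝐪 i F) := by
  refine fun j hj => hF j fun h => hj ?_
  rw [coeff_frobPoly, h, zero_pow (pow_pos Fintype.card_pos _).ne']

theorem frobPoly_ne_zero {F : K[X]} (hF : F ≠ 0) (i : ℕ) : frobPoly 𝐪 i F ≠ 0 := by
  rw [frobPoly_eq_map]
  exact map_ne_zero hF

theorem qDeg_frobPoly (F : K[X]) (i : ℕ) : qDeg 𝐪 r (frobPoly 𝐪 i F) = qDeg 𝐪 r F := by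
  simp only [qDeg, coeff_frobPoly, ne_eq, pow_eq_zero_iff (pow_pos Fintype.card_pos _).ne']

theorem frobPoly_perp (F : K[X]) (i : ℕ) :
    frobPoly 𝐪 i (perp 𝐪 r F) = perp 𝐪 r (frobPoly 𝐪 i F) := by
  rw [perp, perp, qDeg_frobPoly, frobPoly_eq_map, Polynomial.map_sum]
  refine Finset.sum_congr rfl fun j _ => ?_
  simp only [Polynomial.map_mul, map_C, Polynomial.map_pow, map_X, RingHom.coe_coe, map_div₀,
    map_pow, coeff_frobPoly, frobeniusPow_apply]

theorem RightDvd.frobPoly {A B : K[X]} (h : RightDvd 𝐪 r A B) (i : ℕ) :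
    RightDvd 𝐪 r (frobPoly 𝐪 i A) (frobPoly 𝐪 i B) := by
  obtain ⟨Q, hQ, rfl⟩ := h
  exact ⟨_, hQ.frobPoly i, frobPoly_comp i Q A⟩

theorem IsRightGcd.rightDvd_frobPoly [Finite K] {G D : K[X]}
    (hD : IsRightGcd 𝐪 r (fun i : Fin (Module.finrank Fq K) => frobPoly 𝐪 i G) D) (i : ℕ) :
    RightDvd 𝐪 r D (frobPoly 𝐪 i G) :=
  frobPoly_mod_finrank (Fq := Fq) i G ▸ hD.dvd ⟨i % _, Nat.mod_lt _ Module.finrank_pos⟩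

theorem IsRightGcd.rightDvd_frobPoly_one_self [Finite K] {G D : K[X]}
    (hD : IsRightGcd 𝐪 r (fun i : Fin (Module.finrank Fq K) => frobPoly 𝐪 i G) D) :
    RightDvd 𝐪 r D (frobPoly 𝐪 1 D) := by
  have hpos : 0 < Module.finrank Fq K := Module.finrank_pos
  obtain ⟨k, hk⟩ := Nat.exists_eq_succ_of_ne_zero hpos.ne'
  have hDk : RightDvd 𝐪 r (frobPoly 𝐪 k D) D := by
    refine hD.greatest _ (hD.isLinearized.frobPoly k) fun i => ?_
    have hi := (hD.rightDvd_frobPoly (i + 1)).frobPoly k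
    rwa [frobPoly_frobPoly, add_assoc, add_comm 1, ← Nat.succ_eq_add_one, ← hk,
      ← frobPoly_mod_finrank (i + _) G, Nat.add_mod_right, frobPoly_mod_finrank] at hi
  have hD1 := hDk.frobPoly 1
  rwa [frobPoly_frobPoly, ← Nat.succ_eq_add_one, ← hk, ← frobPoly_mod_finrank _ D, Nat.mod_self,
    frobPoly_zero] at hD1

end FrobPoly

section VecPoly

variable {K : Type*} [Field K] {q r n : ℕ}

/-- The map `c ↦ c_0 x + c_1 x^{[r]} + ⋯ + c_{n-1} x^{[(n-1)r]}` as a linear map. -/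
noncomputable def vecPolyLin (K : Type*) [Field K] (q r n : ℕ) : (Fin n → K) →ₗ[K] K[X] :=
  Fintype.linearCombination K fun j : Fin n => X ^ q ^ (r * (j : ℕ))

theorem vecPolyLin_apply (c : Fin n → K) : vecPolyLin K q r n c = vecPoly q r c := by
  simp only [vecPolyLin, Fintype.linearCombination_apply, vecPoly, smul_eq_C_mul]

theorem coeff_vecPoly (hq : 1 < q) (hr : 0 < r) (c : Fin n → K) (i : Fin n) :
    (vecPoly q r c).coeff (q ^ (r * (i : ℕ))) = c i := by
  simp [vecPoly, finsetSum_coeff, coeff_X_pow, (q_pow_mul_injective hq hr).eq_iff, ← Fin.ext_iff]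

theorem vecPolyLin_injective (hq : 1 < q) (hr : 0 < r) :
    Function.Injective (vecPolyLin K q r n) := fun c c' h => funext fun i => by
  rw [← coeff_vecPoly hq hr c i, ← coeff_vecPoly hq hr c' i, ← vecPolyLin_apply, h,
    vecPolyLin_apply]

theorem mem_range_vecPolyLin_iff (hq : 1 < q) (hr : 0 < r) {F : K[X]} :
    F ∈ LinearMap.range (vecPolyLin K q r n) ↔
      IsLinearized q r F ∧ F.degree < (q ^ (r * n) : ℕ) := by
  constructor
  · rintro ⟨c, rfl⟩
    rw [vecPolyLin_apply]
    refine ⟨isLinearized_vecPoly c, (degree_sum_le _ _).trans_lt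
      ((Finset.sup_lt_iff (WithBot.bot_lt_coe _)).2 fun i _ => ?_)⟩
    refine (degree_C_mul_X_pow_le _ _).trans_lt ?_
    exact_mod_cast (q_pow_mul_lt_iff hq hr).2 i.2
  · rintro ⟨hF, hdeg⟩
    refine ⟨fun i => F.coeff (q ^ (r * (i : ℕ))), ?_⟩
    rw [vecPolyLin_apply, vecPoly]
    conv_rhs => rw [hF.eq_sum hq hr hdeg, Finset.sum_range]

/-- The code of length `n` consisting of the vectors whose polynomial is a left multiple
of `D`. -/
noncomputable def generatedCode (q r n : ℕ) (D : K[X]) : Submodule K (Fin n → K) :=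
  (leftMultiples q r D).comap (vecPolyLin K q r n)

theorem mem_generatedCode {D : K[X]} {c : Fin n → K} :
    c ∈ generatedCode q r n D ↔ RightDvd q r D (vecPoly q r c) := by
  rw [generatedCode, Submodule.mem_comap, vecPolyLin_apply, mem_leftMultiples]

/-- The residue classes forming the code `C`, as a space of linearized polynomials. -/
noncomputable def codeIdeal (q r : ℕ) (C : Submodule K (Fin n → K)) : Submodule K K[X] :=
  C.map (vecPolyLin K q r n) ⊔ leftMultiples q r (modulus K q r n)

theorem mem_codeIdeal {C : Submodule K (Fin n → K)} {F : K[X]} :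
    F ∈ codeIdeal q r C ↔ MemCode q r C F := by
  rw [codeIdeal, Submodule.mem_sup, MemCode]
  constructor
  · rintro ⟨_, ⟨c, hc, rfl⟩, _, ⟨A, hA, rfl⟩, rfl⟩
    exact ⟨c, hc, A, hA, by rw [vecPolyLin_apply]⟩
  · rintro ⟨c, hc, A, hA, rfl⟩
    exact ⟨_, ⟨c, hc, vecPolyLin_apply c⟩, _, ⟨A, hA, rfl⟩, rfl⟩

theorem modulus_mem_codeIdeal (C : Submodule K (Fin n → K)) :
    modulus K q r n ∈ codeIdeal q r C :=
  Submodule.mem_sup_right (RightDvd.refl _)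

theorem vecPoly_mem_codeIdeal_iff (hq : 1 < q) (hr : 0 < r) (hn : 0 < n)
    {C : Submodule K (Fin n → K)} {c : Fin n → K} : vecPoly q r c ∈ codeIdeal q r C ↔ c ∈ C := by
  refine ⟨fun h => ?_, fun hc => Submodule.mem_sup_left ⟨c, hc, vecPolyLin_apply c⟩⟩
  obtain ⟨c', hc', A, hA, h⟩ := mem_codeIdeal.1 h
  rw [← vecPolyLin_apply, ← vecPolyLin_apply, ← sub_eq_iff_eq_add', ← map_sub] at h
  have hdvd : modulus K q r n ∣ vecPolyLin K q r n (c - c') :=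
    RightDvd.dvd hq ⟨A, hA, h⟩
  have hlt : (vecPolyLin K q r n (c - c')).degree < (modulus K q r n).degree := by
    rw [degree_eq_natDegree (modulus_ne_zero hq hr hn), natDegree_modulus hq hr hn]
    exact ((mem_range_vecPolyLin_iff hq hr).1 ⟨_, rfl⟩).2
  have hsub : c - c' = 0 := (map_eq_zero_iff _ (vecPolyLin_injective hq hr)).1
    (eq_zero_of_dvd_of_degree_lt hdvd hlt)
  exact sub_eq_zero.1 hsub ▸ hc'

end VecPoly

section RankLengthSkewCyclic

variable {Fq K : Type*} [Field Fq] [Fintype Fq] [Field K] [Algebra Fq K] {r n : ℕ}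

local notation "𝐪" => Fintype.card Fq

theorem degree_comp_lt_iff (hr : 0 < r) {D F : K[X]} (hD : IsLinearized 𝐪 r D) (hD0 : D ≠ 0)
    (hF : IsLinearized 𝐪 r F) {d : ℕ} :
    (F.comp D).degree < (𝐪 ^ (r * (d + qDeg 𝐪 r D)) : ℕ) ↔ F.degree < (𝐪 ^ (r * d) : ℕ) := by
  have hq : 1 < 𝐪 := Fintype.one_lt_card
  by_cases hF0 : F = 0
  · simp only [hF0, zero_comp, degree_zero, WithBot.bot_lt_natCast]
  · rw [hF.degree_lt_iff hq hr hF0,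
      (hF.comp hD).degree_lt_iff hq hr (mt (hD.comp_eq_zero_iff hq hD0).1 hF0),
      qDeg_comp hr hF hD hF0 hD0, Nat.add_lt_add_iff_right]

theorem map_vecPolyLin_generatedCode (hr : 0 < r) {D : K[X]} (hD : IsLinearized 𝐪 r D)
    (hD0 : D ≠ 0) (d : ℕ) :
    (generatedCode 𝐪 r (d + qDeg 𝐪 r D) D).map (vecPolyLin K 𝐪 r (d + qDeg 𝐪 r D)) =
      LinearMap.range ((aeval D : K[X] →ₐ[K] K[X]).toLinearMap ∘ₗ vecPolyLin K 𝐪 r d) := by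
  have hq : 1 < 𝐪 := Fintype.one_lt_card
  rw [generatedCode, Submodule.map_comap_eq, LinearMap.range_comp]
  ext F
  rw [Submodule.mem_inf, mem_range_vecPolyLin_iff hq hr, Submodule.mem_map]
  constructor
  · rintro ⟨⟨-, hdeg⟩, Q, hQ, rfl⟩
    exact ⟨Q, (mem_range_vecPolyLin_iff hq hr).2
      ⟨hQ, (degree_comp_lt_iff hr hD hD0 hQ).1 hdeg⟩, (comp_eq_aeval).symm⟩
  · rintro ⟨Q, hQ, rfl⟩
    obtain ⟨hQ, hdeg⟩ := (mem_range_vecPolyLin_iff hq hr).1 hQ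
    rw [AlgHom.toLinearMap_apply, ← comp_eq_aeval]
    exact ⟨⟨hQ.comp hD, (degree_comp_lt_iff hr hD hD0 hQ).2 hdeg⟩, Q, hQ, rfl⟩

theorem finrank_generatedCode_add_qDeg (hr : 0 < r) {D : K[X]} (hD : IsLinearized 𝐪 r D)
    (hD0 : D ≠ 0) (hDn : qDeg 𝐪 r D ≤ n) :
    Module.finrank K (generatedCode 𝐪 r n D) + qDeg 𝐪 r D = n := by
  have hq : 1 < 𝐪 := Fintype.one_lt_card
  obtain ⟨d, rfl⟩ := Nat.exists_eq_add_of_le' hDn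
  have hcomp : Function.Injective (aeval D : K[X] →ₐ[K] K[X]).toLinearMap := by
    refine (injective_iff_map_eq_zero _).2 fun F hF => (hD.comp_eq_zero_iff hq hD0).1 ?_
    rwa [comp_eq_aeval]
  rw [(Submodule.equivMapOfInjective _ (vecPolyLin_injective hq hr) _).finrank_eq,
    map_vecPolyLin_generatedCode hr hD hD0, LinearMap.finrank_range_of_inj, Module.finrank_fin_fun]
  rw [LinearMap.coe_comp]
  exact hcomp.comp (vecPolyLin_injective hq hr)

theorem vecPoly_pow_rightDvd_sub_shift (hn : 0 < n) (c : Fin n → K) :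
    RightDvd 𝐪 r (modulus K 𝐪 r n)
      (vecPoly 𝐪 r c ^ 𝐪 ^ r - vecPoly 𝐪 r (frobVec 𝐪 r (shift c))) := by
  obtain ⟨k, rfl⟩ := Nat.exists_eq_add_of_le' hn
  refine ⟨C (c (Fin.last k) ^ 𝐪 ^ r) * X, isLinearized_X.C_mul _, ?_⟩
  have h0 : shift c 0 = c (Fin.last k) := by
    rw [shift, (finRotate (k + 1)).symm_apply_eq.2 finRotate_last.symm]
  have hs : ∀ j : Fin k, shift c j.succ = c j.castSucc := fun j => by
    rw [shift, (finRotate (k + 1)).symm_apply_eq.2]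
    exact (finRotate_of_lt j.2).symm
  rw [vecPoly, sum_pow_card_pow, Fin.sum_univ_castSucc, vecPoly, Fin.sum_univ_succ]
  simp only [frobVec, h0, hs, modulus, mul_pow, ← C_pow, ← pow_mul, ← pow_add, Fin.val_castSucc,
    Fin.val_last, Fin.val_zero, Fin.val_succ, mul_zero, pow_zero, pow_one, mul_add_one,
    C_mul_comp, X_comp]
  ring

theorem IsSkewCyclic.isLeftIdeal_codeIdeal (hn : 0 < n) {C : Submodule K (Fin n → K)}
    (hC : IsSkewCyclic 𝐪 r C) : IsLeftIdeal 𝐪 r (codeIdeal 𝐪 r C) := by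
  have hM := isLeftIdeal_leftMultiples (isLinearized_modulus (K := K) (q := 𝐪) (r := r) n)
  refine isLeftIdeal_of_pow_mem (fun F hF => ?_) (fun F hF => ?_)
  · obtain ⟨c, -, A, hA, rfl⟩ := mem_codeIdeal.1 hF
    exact (isLinearized_vecPoly c).add (hA.comp (isLinearized_modulus n))
  · obtain ⟨_, ⟨c, hc, rfl⟩, B, hB, rfl⟩ := Submodule.mem_sup.1 hF
    rw [add_pow_card_pow, vecPolyLin_apply,
      ← add_sub_cancel (vecPoly 𝐪 r (frobVec 𝐪 r (shift c))) (vecPoly 𝐪 r c ^ 𝐪 ^ r), add_assoc]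
    refine Submodule.add_mem_sup ⟨_, hC c hc, vecPolyLin_apply _⟩ (Submodule.add_mem _ ?_ ?_)
    · exact vecPoly_pow_rightDvd_sub_shift hn c
    · simpa only [mul_one] using hM.pow_mem hB 1

theorem IsGeneratorPoly.rightDvd (hr : 0 < r) (hn : 0 < n) {C : Submodule K (Fin n → K)}
    (hC : IsSkewCyclic 𝐪 r C) {G : K[X]} (hG : IsGeneratorPoly 𝐪 r C G) {F : K[X]}
    (hF : F ∈ codeIdeal 𝐪 r C) : RightDvd 𝐪 r G F :=
  (hC.isLeftIdeal_codeIdeal hn).rightDvd_of_minimal hr (mem_codeIdeal.2 hG.mem) hG.monic.ne_zero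
    (fun A hA hA0 => hG.minimal A hA0 (mem_codeIdeal.1 hA)) hF

theorem IsGaloisClosed.frobPoly_mem_codeIdeal {C V : Submodule K (Fin n → K)}
    (hV : IsGaloisClosed 𝐪 V) (hCV : C ≤ V) {F : K[X]} (hF : F ∈ codeIdeal 𝐪 r C) (i : ℕ) :
    frobPoly 𝐪 i F ∈ codeIdeal 𝐪 r V := by
  obtain ⟨c, hc, A, hA, rfl⟩ := mem_codeIdeal.1 hF
  refine mem_codeIdeal.2 ⟨frobVec 𝐪 i c, hV.frobVec_mem i (hCV hc), frobPoly 𝐪 i A,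
    hA.frobPoly i, ?_⟩
  rw [frobPoly_add, frobPoly_vecPoly, frobPoly_comp, frobPoly_modulus]

theorem isGaloisClosed_generatedCode {D : K[X]} (hD : RightDvd 𝐪 r D (frobPoly 𝐪 1 D)) :
    IsGaloisClosed 𝐪 (generatedCode 𝐪 r n D) := by
  intro c hc
  rw [mem_generatedCode, ← frobPoly_vecPoly]
  exact hD.trans ((mem_generatedCode.1 hc).frobPoly 1)

theorem leftSpan_frobPoly_le_codeIdeal {ι : Type*} (f : ι → ℕ) {C V : Submodule K (Fin n → K)}
    (hC : IsLeftIdeal 𝐪 r (codeIdeal 𝐪 r C)) (hV : IsGaloisClosed 𝐪 V) (hCV : C ≤ V) {G : K[X]}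
    (hG : G ∈ codeIdeal 𝐪 r C) :
    leftSpan 𝐪 r (Set.range fun i => frobPoly 𝐪 (f i) G) ≤ codeIdeal 𝐪 r V := by
  refine Submodule.span_le.2 ?_
  rintro _ ⟨_, ⟨i, rfl⟩, j, rfl⟩
  exact frobPoly_pow (Fq := Fq) (f i) G _ ▸
    hV.frobPoly_mem_codeIdeal hCV (hC.pow_mem hG j) (f i)

theorem IsRightGcd.rightDvd_of_mem_codeIdeal [Finite K] (hr : 0 < r) (hn : 0 < n)
    {C : Submodule K (Fin n → K)} (hC : IsSkewCyclic 𝐪 r C) {G : K[X]}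
    (hG : IsGeneratorPoly 𝐪 r C G) {D : K[X]}
    (hD : IsRightGcd 𝐪 r (fun i : Fin (Module.finrank Fq K) => frobPoly 𝐪 i G) D) {F : K[X]}
    (hF : F ∈ codeIdeal 𝐪 r C) : RightDvd 𝐪 r D F :=
  (frobPoly_zero (Fq := Fq) G ▸ hD.rightDvd_frobPoly 0).trans (hG.rightDvd hr hn hC hF)

theorem rankLength_add_qDeg_gcd [Finite K] (hr : 0 < r) (hn : 0 < n) {C : Submodule K (Fin n → K)}
    (hC : IsSkewCyclic 𝐪 r C) {G : K[X]} (hG : IsGeneratorPoly 𝐪 r C G) {D : K[X]}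
    (hD : IsRightGcd 𝐪 r (fun i : Fin (Module.finrank Fq K) => frobPoly 𝐪 i G) D) :
    rankLength Fq C + qDeg 𝐪 r D = n := by
  have hq : 1 < 𝐪 := Fintype.one_lt_card
  have hGi : ∀ i : Fin (Module.finrank Fq K), IsLinearized 𝐪 r (frobPoly 𝐪 i G) :=
    fun i => hG.isLinearized.frobPoly i
  have hDn : qDeg 𝐪 r D ≤ n := by
    have h := hD.rightDvd_of_mem_codeIdeal hr hn hC hG (modulus_mem_codeIdeal C)
    exact (h.qDeg_le hq hr hD.isLinearized (isLinearized_modulus n)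
      (modulus_ne_zero hq hr hn)).trans_eq (qDeg_modulus hq hr hn)
  have hDspan : leftMultiples 𝐪 r D ≤
      leftSpan 𝐪 r (Set.range fun i : Fin (Module.finrank Fq K) => frobPoly 𝐪 i G) :=
    (isLeftIdeal_leftSpan (Set.forall_mem_range.2 hGi)).leftMultiples_le
      (hD.mem_leftSpan hr hGi ⟨⟨0, Module.finrank_pos⟩, frobPoly_ne_zero hG.monic.ne_zero 0⟩)
  rw [rankLength_eq_finrank (V := generatedCode 𝐪 r n D)
    (isGaloisClosed_generatedCode hD.rightDvd_frobPoly_one_self) ?_ ?_,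
    finrank_generatedCode_add_qDeg hr hD.isLinearized hD.monic.ne_zero hDn]
  · exact fun c hc => mem_generatedCode.2
      (hD.rightDvd_of_mem_codeIdeal hr hn hC hG ((vecPoly_mem_codeIdeal_iff hq hr hn).2 hc))
  · exact fun V hV hCV c hc => (vecPoly_mem_codeIdeal_iff hq hr hn).1
      (leftSpan_frobPoly_le_codeIdeal _ (hC.isLeftIdeal_codeIdeal hn) hV hCV
        (mem_codeIdeal.2 hG.mem) (hDspan (mem_generatedCode.1 hc)))

end RankLengthSkewCyclic

section RootSpaces

variable {K E L : Type*} [Field K] [Field E] [Field L] [Algebra K L] [Algebra E L] {q r n : ℕ}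

theorem RightDvd.rootSpace_le (hq : 1 < q) {A B : K[X]} (h : RightDvd q r A B) :
    rootSpace E L A ≤ rootSpace E L B :=
  Submodule.span_mono fun _ hz => aeval_eq_zero_of_dvd_aeval_eq_zero (h.dvd hq) hz

variable [Fintype E]

theorem exists_linearMap_aeval (hE : Fintype.card E = q ^ r) {F : K[X]}
    (hF : IsLinearized q r F) : ∃ φ : L →ₗ[E] L, ∀ z, φ z = aeval z F := by
  refine hF.induction (P := fun F => ∃ φ : L →ₗ[E] L, ∀ z, φ z = aeval z F) ?_ ?_ ?_
  · exact ⟨0, fun z => (map_zero _).symm⟩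
  · rintro A B ⟨φ, hφ⟩ ⟨ψ, hψ⟩
    exact ⟨φ + ψ, fun z => by rw [LinearMap.add_apply, hφ, hψ, map_add]⟩
  · intro a i
    refine ⟨LinearMap.mulLeft E (algebraMap K L a) ∘ₗ (frobeniusPow E L i).toLinearMap,
      fun z => ?_⟩
    rw [LinearMap.comp_apply, AlgHom.toLinearMap_apply, frobeniusPow_apply, hE, ← pow_mul,
      LinearMap.mulLeft_apply, map_mul, aeval_C, map_pow, aeval_X]

theorem ker_eq_rootSpace (hE : Fintype.card E = q ^ r) {F : K[X]} (hF : IsLinearized q r F)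
    {φ : L →ₗ[E] L} (hφ : ∀ z, φ z = aeval z F) : LinearMap.ker φ = rootSpace E L F := by
  ext z
  rw [LinearMap.mem_ker, hφ, mem_rootSpace hE hF]

theorem finrank_rootSpace_le [Finite L] (hE : Fintype.card E = q ^ r) (hq : 1 < q) (hr : 0 < r)
    {F : K[X]} (hF : IsLinearized q r F) (hF0 : F ≠ 0) :
    Module.finrank E (rootSpace E L F) ≤ qDeg q r F := by
  classical
  have hcard : Nat.card (rootSpace E L F) ≤ F.natDegree := by
    have hsub : (rootSpace E L F : Set L) ⊆ F.rootSet L := fun z hz =>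
      mem_rootSet.2 ⟨hF0, (mem_rootSpace hE hF z).1 hz⟩
    calc Nat.card (rootSpace E L F) = (rootSpace E L F : Set L).ncard := Nat.card_coe_set_eq _
      _ ≤ (F.rootSet L).ncard := Set.ncard_le_ncard hsub
      _ = (F.map (algebraMap K L)).roots.toFinset.card := Set.ncard_coe_finset _
      _ ≤ (F.map (algebraMap K L)).roots.card := Multiset.toFinset_card_le _
      _ ≤ F.natDegree := (card_roots' _).trans_eq (natDegree_map _)
  rw [Module.natCard_eq_pow_finrank (K := E), Nat.card_eq_fintype_card, hE, ← pow_mul,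
    hF.natDegree_eq hq hr hF0, Nat.pow_le_pow_iff_right hq] at hcard
  exact Nat.le_of_mul_le_mul_left hcard hr

theorem aeval_modulus [Finite L] (hE : Fintype.card E = q ^ r) (hEL : Module.finrank E L = n)
    (z : L) : aeval z (modulus K q r n) = 0 := by
  rw [modulus, map_sub, map_pow, aeval_X, pow_mul, ← hE, pow_card_pow_eq_self hEL.dvd, sub_self]

variable {Fq : Type*} [Field Fq] [Fintype Fq] [Algebra Fq K]

local notation "𝐪" => Fintype.card Fq

theorem rootSpace_eq_iInf_of_isRightGcd (hE : Fintype.card E = 𝐪 ^ r) (hr : 0 < r) {ι : Type*}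
    {F : ι → K[X]} (hF : ∀ i, IsLinearized 𝐪 r (F i)) (h0 : ∃ i, F i ≠ 0) {D : K[X]}
    (hD : IsRightGcd 𝐪 r F D) : rootSpace E L D = ⨅ i, rootSpace E L (F i) := by
  refine le_antisymm (le_iInf fun i => (hD.dvd i).rootSpace_le Fintype.one_lt_card)
    fun z hz => (mem_rootSpace hE hD.isLinearized z).2 ?_
  suffices h : leftSpan 𝐪 r (Set.range F) ≤ LinearMap.ker (aeval (R := K) z).toLinearMap from
    h (hD.mem_leftSpan hr hF h0)
  refine Submodule.span_le.2 ?_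
  rintro _ ⟨_, ⟨i, rfl⟩, j, rfl⟩
  have hFz : aeval z (F i) = 0 := (mem_rootSpace hE (hF i) z).1 ((Submodule.mem_iInf _).1 hz i)
  rw [SetLike.mem_coe, LinearMap.mem_ker, AlgHom.toLinearMap_apply, map_pow, hFz,
    zero_pow (pow_pos Fintype.card_pos _).ne']

theorem aeval_pow_frobPoly [Algebra Fq L] (i : ℕ) (F : K[X]) (w : L) :
    aeval (w ^ 𝐪 ^ i) (frobPoly 𝐪 i F) = aeval w F ^ 𝐪 ^ i := by
  have hcomp : (algebraMap K L).comp (frobeniusPow Fq K i : K →+* K) =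
      (frobeniusPow Fq L i : L →+* L).comp (algebraMap K L) := by
    ext a
    simp only [RingHom.comp_apply, RingHom.coe_coe, frobeniusPow_apply, map_pow]
  rw [← frobeniusPow_apply, ← frobeniusPow_apply, frobPoly_eq_map, aeval_def, eval₂_map, hcomp,
    ← RingHom.coe_coe, ← hom_eval₂, aeval_def]

variable [Finite L]

theorem rightDvd_of_rootSpace_le (hE : Fintype.card E = 𝐪 ^ r) (hr : 0 < r) {A B : K[X]}
    (hA : IsLinearized 𝐪 r A) (hA0 : A ≠ 0)
    (hdim : Module.finrank E (rootSpace E L A) = qDeg 𝐪 r A) (hB : IsLinearized 𝐪 r B)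
    (hle : rootSpace E L A ≤ rootSpace E L B) : RightDvd 𝐪 r A B := by
  have hq : 1 < 𝐪 := Fintype.one_lt_card
  obtain ⟨Q, hQ, hlt⟩ := exists_degree_sub_comp_lt_divisor hr hA hB hA0
  have hR : IsLinearized 𝐪 r (B - Q.comp A) := hB.sub (hQ.comp hA)
  have hAR : rootSpace E L A ≤ rootSpace E L (B - Q.comp A) := fun z hz => by
    have hBz := (mem_rootSpace hE hB z).1 (hle hz)
    have hQz := (mem_rootSpace hE (hQ.comp hA) z).1 (RightDvd.rootSpace_le hq ⟨Q, hQ, rfl⟩ hz)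
    rw [mem_rootSpace hE hR, map_sub, hBz, hQz, sub_zero]
  refine ⟨Q, hQ, sub_eq_zero.1 (by_contra fun hR0 => hlt.not_ge ?_)⟩
  rw [hA.degree_eq hq hr hA0, hR.degree_eq hq hr hR0, Nat.cast_le]
  exact Nat.pow_le_pow_right hq.le (Nat.mul_le_mul_left r (hdim.symm.trans_le
    ((Submodule.finrank_mono hAR).trans (finrank_rootSpace_le hE hq hr hR hR0))))

theorem powSpace_rootSpace [Algebra Fq E] [Algebra Fq L] [IsScalarTower Fq E L]
    (hE : Fintype.card E = 𝐪 ^ r) {F : K[X]} (hF : IsLinearized 𝐪 r F) (i : ℕ) :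
    powSpace 𝐪 i (rootSpace E L F) = rootSpace E L (frobPoly 𝐪 i F) := by
  have hpow : (𝐪 ^ i : ℕ) ≠ 0 := (pow_pos Fintype.card_pos i).ne'
  ext z
  obtain ⟨w, rfl⟩ := pow_card_pow_surjective (Fq := Fq) i z
  rw [mem_powSpace, mem_rootSpace hE (hF.frobPoly i), aeval_pow_frobPoly, pow_eq_zero_iff hpow,
    ← mem_rootSpace hE hF]
  exact ⟨fun ⟨_, hw, h⟩ => pow_card_pow_injective i h ▸ hw, fun hw => ⟨w, hw, rfl⟩⟩

theorem powSpace_rootSpace_perp [Algebra Fq E] [Algebra Fq L] [IsScalarTower Fq E L]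
    (hE : Fintype.card E = 𝐪 ^ r) (F : K[X]) (i : ℕ) :
    powSpace 𝐪 i (rootSpace E L (perp 𝐪 r F)) = rootSpace E L (perp 𝐪 r (frobPoly 𝐪 i F)) := by
  rw [powSpace_rootSpace hE (isLinearized_perp F), frobPoly_perp]

end RootSpaces

section CheckPoly

variable {K E L : Type*} [Field K] [Field E] [Fintype E] [Field L] [Algebra K L] [Algebra E L]
  {q r n : ℕ} {G H : K[X]}

theorem IsCheckPoly.symm (hGH : IsCheckPoly q r n G H) (hG : IsLinearized q r G) :
    IsCheckPoly q r n H G :=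
  ⟨hG, hGH.check_comp_gen, hGH.gen_comp_check⟩

theorem IsCheckPoly.rightDvd_modulus (hGH : IsCheckPoly q r n G H) :
    RightDvd q r G (modulus K q r n) :=
  ⟨H, hGH.isLinearized, hGH.check_comp_gen.symm⟩

theorem IsCheckPoly.ne_zero (hGH : IsCheckPoly q r n G H) (hq : 1 < q) (hr : 0 < r)
    (hn : 0 < n) : G ≠ 0 :=
  ne_zero_of_dvd_ne_zero (modulus_ne_zero hq hr hn) (hGH.rightDvd_modulus.dvd hq)

theorem IsCheckPoly.range_le_rootSpace [Finite L] (hGH : IsCheckPoly q r n G H)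
    (hG : IsLinearized q r G) (hE : Fintype.card E = q ^ r) (hEL : Module.finrank E L = n)
    {φ : L →ₗ[E] L} (hφ : ∀ z, φ z = aeval z H) : LinearMap.range φ ≤ rootSpace E L G := by
  rintro _ ⟨z, rfl⟩
  rw [mem_rootSpace hE hG, hφ, ← aeval_comp, hGH.gen_comp_check, aeval_modulus hE hEL]

variable {Fq : Type*} [Field Fq] [Fintype Fq] [Algebra Fq K] [Finite L]

local notation "𝐪" => Fintype.card Fq

theorem IsCheckPoly.frobPoly (hGH : IsCheckPoly 𝐪 r n G H) (i : ℕ) :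
    IsCheckPoly 𝐪 r n (frobPoly 𝐪 i G) (frobPoly 𝐪 i H) where
  isLinearized := hGH.isLinearized.frobPoly i
  gen_comp_check := by rw [← frobPoly_comp, hGH.gen_comp_check, frobPoly_modulus]
  check_comp_gen := by rw [← frobPoly_comp, hGH.check_comp_gen, frobPoly_modulus]

theorem IsCheckPoly.qDeg_add_qDeg (hGH : IsCheckPoly 𝐪 r n G H) (hG : IsLinearized 𝐪 r G)
    (hr : 0 < r) (hn : 0 < n) : qDeg 𝐪 r G + qDeg 𝐪 r H = n := by
  have hq : 1 < 𝐪 := Fintype.one_lt_card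
  rw [← qDeg_comp hr hG hGH.isLinearized (hGH.ne_zero hq hr hn) ((hGH.symm hG).ne_zero hq hr hn),
    hGH.gen_comp_check, qDeg_modulus hq hr hn]

theorem comp_modulus [Finite K] (hK : Module.finrank Fq K ∣ r * n) {F : K[X]}
    (hF : IsLinearized 𝐪 r F) : F.comp (modulus K 𝐪 r n) = (modulus K 𝐪 r n).comp F := by
  refine hF.induction (P := fun F => F.comp (modulus K 𝐪 r n) = (modulus K 𝐪 r n).comp F) ?_ ?_ ?_
  · rw [zero_comp, modulus, sub_comp, X_pow_comp, X_comp, zero_pow (pow_pos Fintype.card_pos _).ne',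
      sub_zero]
  · intro A B hA hB
    rw [add_comp, hA, hB]
    simp only [modulus, sub_comp, X_pow_comp, X_comp, add_pow_card_pow, add_sub_add_comm]
  · intro a i
    simp only [modulus, mul_comp, C_comp, sub_comp, X_pow_comp, X_comp, sub_pow_card_pow, mul_pow,
      ← C_pow, pow_card_pow_eq_self hK]
    ring

theorem exists_isCheckPoly [Finite K] (hK : Module.finrank Fq K ∣ r * n) (hr : 0 < r) (hn : 0 < n)
    {D : K[X]} (hD : IsLinearized 𝐪 r D) (hdvd : RightDvd 𝐪 r D (modulus K 𝐪 r n)) :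
    ∃ H, IsCheckPoly 𝐪 r n D H := by
  have hq : 1 < 𝐪 := Fintype.one_lt_card
  have hD0 : D ≠ 0 := ne_zero_of_dvd_ne_zero (modulus_ne_zero hq hr hn) (hdvd.dvd hq)
  obtain ⟨H, hH, h⟩ := hdvd
  refine ⟨H, hH, sub_eq_zero.1 ((hD.comp_eq_zero_iff hq hD0).1 ?_), h.symm⟩
  rw [sub_comp, comp_assoc, ← h, comp_modulus hK hD, sub_self]

theorem IsCheckPoly.finrank_rootSpace (hGH : IsCheckPoly 𝐪 r n G H) (hG : IsLinearized 𝐪 r G)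
    (hE : Fintype.card E = 𝐪 ^ r) (hEL : Module.finrank E L = n) (hr : 0 < r) (hn : 0 < n) :
    Module.finrank E (rootSpace E L G) = qDeg 𝐪 r G := by
  have hq : 1 < 𝐪 := Fintype.one_lt_card
  obtain ⟨φ, hφ⟩ := exists_linearMap_aeval (L := L) hE hGH.isLinearized
  have hrank := LinearMap.finrank_range_add_finrank_ker φ
  rw [ker_eq_rootSpace hE hGH.isLinearized hφ, hEL] at hrank
  have hrange := Submodule.finrank_mono (hGH.range_le_rootSpace hG hE hEL hφ)
  have hdimG := finrank_rootSpace_le (L := L) hE hq hr hG (hGH.ne_zero hq hr hn)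
  have hdimH := finrank_rootSpace_le (L := L) hE hq hr hGH.isLinearized
    ((hGH.symm hG).ne_zero hq hr hn)
  have hdeg := hGH.qDeg_add_qDeg hG hr hn
  omega

theorem IsCheckPoly.range_eq_rootSpace (hGH : IsCheckPoly 𝐪 r n G H) (hG : IsLinearized 𝐪 r G)
    (hE : Fintype.card E = 𝐪 ^ r) (hEL : Module.finrank E L = n) (hr : 0 < r) (hn : 0 < n)
    {φ : L →ₗ[E] L} (hφ : ∀ z, φ z = aeval z H) : LinearMap.range φ = rootSpace E L G := by
  refine Submodule.eq_of_le_of_finrank_eq (hGH.range_le_rootSpace hG hE hEL hφ) ?_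
  have hrank := LinearMap.finrank_range_add_finrank_ker φ
  rw [ker_eq_rootSpace hE hGH.isLinearized hφ, hEL,
    (hGH.symm hG).finrank_rootSpace hGH.isLinearized hE hEL hr hn,
    ← hGH.qDeg_add_qDeg hG hr hn] at hrank
  rw [hGH.finrank_rootSpace hG hE hEL hr hn]
  exact Nat.add_right_cancel hrank

end CheckPoly

section Perp

variable {K : Type*} [Field K] {q r n : ℕ} {F : K[X]}

theorem IsLinearized.coeff_one_ne_zero (hF : IsLinearized q r F) (hq : 1 < q) (hr : 0 < r)
    (hn : 0 < n) (hdvd : F ∣ modulus K q r n) : F.coeff 1 ≠ 0 := by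
  intro h1
  have hX : X ^ 2 ∣ F := X_pow_dvd_iff.2 fun d hd => by
    interval_cases d
    exacts [hF.coeff_zero hq, h1]
  have hcoeff : (modulus K q r n).coeff 1 = 0 := X_pow_dvd_iff.1 (hX.trans hdvd) 1 one_lt_two
  rw [modulus, coeff_sub, coeff_X_pow, if_neg (Nat.one_lt_pow (Nat.mul_pos hr hn).ne' hq).ne,
    coeff_X_one, zero_sub, neg_eq_zero] at hcoeff
  exact one_ne_zero hcoeff

theorem IsCheckPoly.coeff_one_ne_zero {G H : K[X]} (hGH : IsCheckPoly q r n G H)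
    (hG : IsLinearized q r G) (hq : 1 < q) (hr : 0 < r) (hn : 0 < n) : H.coeff 1 ≠ 0 :=
  hGH.isLinearized.coeff_one_ne_zero hq hr hn ((hGH.symm hG).rightDvd_modulus.dvd hq)

theorem degree_perp_sub_X_pow_lt (hq : 1 < q) (hr : 0 < r) (h1 : F.coeff 1 ≠ 0) :
    (perp q r F - X ^ q ^ (r * qDeg q r F)).degree <
      ((q ^ (r * qDeg q r F) : ℕ) : WithBot ℕ) := by
  rw [← pow_zero q, ← mul_zero r] at h1
  rw [perp, Finset.sum_range_succ, Nat.sub_self, mul_comm r (qDeg q r F),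
    div_self (pow_ne_zero _ h1), C_1, one_mul, add_sub_cancel_right]
  refine (degree_sum_le _ _).trans_lt
    ((Finset.sup_lt_iff (WithBot.bot_lt_coe _)).2 fun i hi =>
      (degree_C_mul_X_pow_le _ _).trans_lt ?_)
  rw [Nat.cast_lt, mul_comm (qDeg q r F), q_pow_mul_lt_iff hq hr]
  exact Finset.mem_range.1 hi

theorem perp_monic (hq : 1 < q) (hr : 0 < r) (h1 : F.coeff 1 ≠ 0) : (perp q r F).Monic := by
  rw [← add_sub_cancel (X ^ q ^ (r * qDeg q r F)) (perp q r F)]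
  exact monic_X_pow_add (degree_perp_sub_X_pow_lt hq hr h1)

theorem qDeg_perp (hq : 1 < q) (hr : 0 < r) (h1 : F.coeff 1 ≠ 0) :
    qDeg q r (perp q r F) = qDeg q r F := by
  refine (isLinearized_perp F).qDeg_eq_of_natDegree_eq hq hr ?_
  rw [← add_sub_cancel (X ^ q ^ (r * qDeg q r F)) (perp q r F)]
  rw [natDegree_add_eq_left_of_degree_lt, natDegree_X_pow]
  rw [degree_X_pow]
  exact degree_perp_sub_X_pow_lt hq hr h1

theorem IsCheckPoly.qDeg_add_qDeg_perp {Fq : Type*} [Field Fq] [Fintype Fq] [Algebra Fq K]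
    {G H : K[X]} (hGH : IsCheckPoly (Fintype.card Fq) r n G H)
    (hG : IsLinearized (Fintype.card Fq) r G) (hr : 0 < r) (hn : 0 < n) :
    qDeg (Fintype.card Fq) r G + qDeg (Fintype.card Fq) r (perp (Fintype.card Fq) r H) = n := by
  have h1 := hGH.coeff_one_ne_zero hG Fintype.one_lt_card hr hn
  rw [qDeg_perp Fintype.one_lt_card hr h1, hGH.qDeg_add_qDeg hG hr hn]

end Perp

section Duality

theorem orthogonal_iSup {E V ι : Type*} [Field E] [AddCommGroup V] [Module E V]
    (B : LinearMap.BilinForm E V) (W : ι → Submodule E V) :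
    B.orthogonal (⨆ i, W i) = ⨅ i, B.orthogonal (W i) := by
  refine le_antisymm
    (le_iInf fun i => LinearMap.BilinForm.orthogonal_le (le_iSup W i)) fun v hv => ?_
  have hle : ⨆ i, W i ≤ LinearMap.ker (B.flip v) :=
    iSup_le fun i u hu => (Submodule.mem_iInf _).1 hv i u hu
  exact fun u hu => hle hu

theorem iSup_orthogonal {E V ι : Type*} [Field E] [AddCommGroup V] [Module E V]
    [FiniteDimensional E V] {B : LinearMap.BilinForm E V} (hB : B.Nondegenerate)
    (hB' : B.IsRefl) (W : ι → Submodule E V) :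
    ⨆ i, B.orthogonal (W i) = B.orthogonal (⨅ i, W i) := by
  rw [← LinearMap.BilinForm.orthogonal_orthogonal hB hB' (⨆ i, B.orthogonal (W i)),
    orthogonal_iSup]
  simp only [LinearMap.BilinForm.orthogonal_orthogonal hB hB']

variable {K E L : Type*} [Field K] [Field E] [Fintype E] [Field L] [Finite L] [Algebra K L]
  [Algebra E L] {q r n : ℕ}

theorem trace_pow_card_pow (i : ℕ) (z : L) :
    Algebra.trace E L (z ^ Fintype.card E ^ i) = Algebra.trace E L z := by
  have hbij : Function.Bijective (frobeniusPow E L i) :=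
    Finite.injective_iff_bijective.1 (frobeniusPow E L i).injective
  rw [← frobeniusPow_apply]
  exact Algebra.trace_eq_of_algEquiv (AlgEquiv.ofBijective _ hbij) z

/- Read backwards, the terms of the expansion on the right are conjugates over `E` of the terms on
the left, and conjugate elements have the same trace. -/
theorem trace_aeval_mul (hE : Fintype.card E = q ^ r) (hq : 1 < q) (hr : 0 < r) {H : K[X]}
    (hH : IsLinearized q r H) (h1 : H.coeff 1 ≠ 0) (y z : L) :
    Algebra.trace E L (aeval z H * y) = Algebra.trace E L
      (aeval y (perp q r H) * (algebraMap K L (H.coeff 1) * z) ^ q ^ (r * qDeg q r H)) := by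
  set k := qDeg q r H with hk
  have h1' : algebraMap K L (H.coeff 1) ≠ 0 := (_root_.map_ne_zero _).2 h1
  have hleft : aeval z H = ∑ i ∈ Finset.range (k + 1),
      algebraMap K L (H.coeff (q ^ (r * i))) * z ^ q ^ (r * i) := by
    have h0 : H ≠ 0 := fun h => h1 (h ▸ coeff_zero 1)
    conv_lhs => rw [hH.eq_sum hq hr ((hH.degree_lt_iff hq hr h0).2 (Nat.lt_succ_self k))]
    simp only [map_sum, map_mul, aeval_C, map_pow, aeval_X]
  have hright : aeval y (perp q r H) * (algebraMap K L (H.coeff 1) * z) ^ q ^ (r * k) =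
      ∑ i ∈ Finset.range (k + 1),
        (algebraMap K L (H.coeff (q ^ (r * i))) * z ^ q ^ (r * i) * y) ^ q ^ (r * (k - i)) := by
    rw [← Finset.sum_range_reflect, perp, map_sum, Finset.sum_mul]
    refine Finset.sum_congr rfl fun i hi => ?_
    have hik : i ≤ k := Nat.lt_succ_iff.1 (Finset.mem_range.1 hi)
    rw [← hk, Nat.add_sub_cancel, Nat.sub_sub_self hik, mul_pow, mul_pow, mul_pow, ← pow_mul z,
      ← pow_add, ← mul_add, Nat.sub_add_cancel hik, map_mul, aeval_C, map_pow, aeval_X, map_div₀,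
      map_pow, map_pow, mul_zero, pow_zero, mul_comm i r, mul_comm k r]
    field_simp
  rw [hright, hleft, Finset.sum_mul, map_sum, map_sum]
  refine Finset.sum_congr rfl fun i _ => ?_
  rw [pow_mul q r (k - i), ← hE, trace_pow_card_pow]

variable {Fq : Type*} [Field Fq] [Fintype Fq] [Algebra Fq K] {G H : K[X]}

local notation "𝐪" => Fintype.card Fq

theorem IsCheckPoly.rootSpace_perp (hGH : IsCheckPoly 𝐪 r n G H) (hG : IsLinearized 𝐪 r G)
    (hE : Fintype.card E = 𝐪 ^ r) (hEL : Module.finrank E L = n) (hr : 0 < r) (hn : 0 < n) :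
    rootSpace E L (perp 𝐪 r H) = (Algebra.traceForm E L).orthogonal (rootSpace E L G) := by
  have h1 := hGH.coeff_one_ne_zero hG Fintype.one_lt_card hr hn
  have h1' : algebraMap K L (H.coeff 1) ≠ 0 := (_root_.map_ne_zero _).2 h1
  have htrace := trace_aeval_mul (L := L) hE Fintype.one_lt_card hr hGH.isLinearized h1
  obtain ⟨φ, hφ⟩ := exists_linearMap_aeval (L := L) hE hGH.isLinearized
  ext y
  rw [mem_rootSpace hE (isLinearized_perp H), LinearMap.BilinForm.mem_orthogonal_iff,
    ← hGH.range_eq_rootSpace hG hE hEL hr hn hφ]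
  constructor
  · rintro hy _ ⟨z, rfl⟩
    rw [Algebra.traceForm_apply, hφ, htrace, hy, zero_mul, map_zero]
  · refine fun hy => (traceForm_nondegenerate E L).1 _ fun w => ?_
    obtain ⟨v, rfl⟩ := pow_card_pow_surjective (Fq := E) (qDeg 𝐪 r H) w
    have hyv := hy _ ⟨(algebraMap K L (H.coeff 1))⁻¹ * v, rfl⟩
    rwa [Algebra.traceForm_apply, hφ, htrace, mul_inv_cancel_left₀ h1', pow_mul 𝐪, ← hE] at hyv

theorem IsCheckPoly.finrank_rootSpace_perp (hGH : IsCheckPoly 𝐪 r n G H)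
    (hG : IsLinearized 𝐪 r G) (hE : Fintype.card E = 𝐪 ^ r) (hEL : Module.finrank E L = n)
    (hr : 0 < r) (hn : 0 < n) :
    Module.finrank E (rootSpace E L (perp 𝐪 r H)) = qDeg 𝐪 r (perp 𝐪 r H) := by
  rw [hGH.rootSpace_perp hG hE hEL hr hn,
    LinearMap.BilinForm.finrank_orthogonal (traceForm_nondegenerate E L),
    hGH.finrank_rootSpace hG hE hEL hr hn, hEL]
  exact Nat.sub_eq_of_eq_add' (hGH.qDeg_add_qDeg_perp hG hr hn).symm

theorem isRightLcm_of_rootSpace_eq_iSup (hE : Fintype.card E = 𝐪 ^ r) (hr : 0 < r) {ι : Type*}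
    {F : ι → K[X]} (hF : ∀ i, IsLinearized 𝐪 r (F i)) (hF0 : ∀ i, F i ≠ 0)
    (hFdim : ∀ i, Module.finrank E (rootSpace E L (F i)) = qDeg 𝐪 r (F i)) {M : K[X]}
    (hM : IsLinearized 𝐪 r M) (hMonic : M.Monic)
    (hMdim : Module.finrank E (rootSpace E L M) = qDeg 𝐪 r M)
    (hroot : rootSpace E L M = ⨆ i, rootSpace E L (F i)) : IsRightLcm 𝐪 r F M where
  isLinearized := hM
  monic := hMonic
  dvd i := rightDvd_of_rootSpace_le hE hr (hF i) (hF0 i) (hFdim i) hM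
    (hroot ▸ le_iSup (fun i => rootSpace E L (F i)) i)
  least _ hM' hdvd := rightDvd_of_rootSpace_le hE hr hM hMonic.ne_zero hMdim hM'
    (hroot ▸ iSup_le fun i => (hdvd i).rootSpace_le Fintype.one_lt_card)

section Family

variable {ι : Type*} [Nonempty ι] {G H : ι → K[X]} {D D' : K[X]}

theorem exists_isRightGcd_isCheckPoly [Finite K] (hK : Module.finrank Fq K ∣ r * n) (hr : 0 < r)
    (hn : 0 < n) (hG : ∀ i, IsLinearized 𝐪 r (G i)) (hGH : ∀ i, IsCheckPoly 𝐪 r n (G i) (H i)) :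
    ∃ D D', IsRightGcd 𝐪 r G D ∧ IsCheckPoly 𝐪 r n D D' := by
  obtain ⟨i⟩ := ‹Nonempty ι›
  obtain ⟨D, -, hD⟩ := exists_isRightGcd_mem_leftSpan hr hG
    ⟨i, (hGH i).ne_zero Fintype.one_lt_card hr hn⟩
  obtain ⟨D', hDD'⟩ := exists_isCheckPoly hK hr hn hD.isLinearized
    ((hD.dvd i).trans (hGH i).rightDvd_modulus)
  exact ⟨D, D', hD, hDD'⟩

theorem IsRightGcd.rootSpace_perp_eq_iSup (hD : IsRightGcd 𝐪 r G D)
    (hG : ∀ i, IsLinearized 𝐪 r (G i)) (hGH : ∀ i, IsCheckPoly 𝐪 r n (G i) (H i))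
    (hDD' : IsCheckPoly 𝐪 r n D D') (hE : Fintype.card E = 𝐪 ^ r)
    (hEL : Module.finrank E L = n) (hr : 0 < r) (hn : 0 < n) :
    rootSpace E L (perp 𝐪 r D') = ⨆ i, rootSpace E L (perp 𝐪 r (H i)) := by
  have hG0 : ∃ i, G i ≠ 0 := ⟨_, (hGH (Classical.arbitrary ι)).ne_zero Fintype.one_lt_card hr hn⟩
  rw [hDD'.rootSpace_perp hD.isLinearized hE hEL hr hn,
    rootSpace_eq_iInf_of_isRightGcd hE hr hG hG0 hD,
    ← iSup_orthogonal (traceForm_nondegenerate E L) (Algebra.traceForm_isSymm E).isRefl]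
  exact iSup_congr fun i => ((hGH i).rootSpace_perp (hG i) hE hEL hr hn).symm

theorem IsRightGcd.isRightLcm_perp (hD : IsRightGcd 𝐪 r G D)
    (hG : ∀ i, IsLinearized 𝐪 r (G i)) (hGH : ∀ i, IsCheckPoly 𝐪 r n (G i) (H i))
    (hDD' : IsCheckPoly 𝐪 r n D D') (hE : Fintype.card E = 𝐪 ^ r)
    (hEL : Module.finrank E L = n) (hr : 0 < r) (hn : 0 < n) :
    IsRightLcm 𝐪 r (fun i => perp 𝐪 r (H i)) (perp 𝐪 r D') :=
  have hq : 1 < 𝐪 := Fintype.one_lt_card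
  isRightLcm_of_rootSpace_eq_iSup hE hr (fun i => isLinearized_perp (H i))
    (fun i => (perp_monic hq hr ((hGH i).coeff_one_ne_zero (hG i) hq hr hn)).ne_zero)
    (fun i => (hGH i).finrank_rootSpace_perp (hG i) hE hEL hr hn) (isLinearized_perp D')
    (perp_monic hq hr (hDD'.coeff_one_ne_zero hD.isLinearized hq hr hn))
    (hDD'.finrank_rootSpace_perp hD.isLinearized hE hEL hr hn)
    (hD.rootSpace_perp_eq_iSup hG hGH hDD' hE hEL hr hn)

theorem IsRightGcd.finrank_iInf_rootSpace (hD : IsRightGcd 𝐪 r G D)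
    (hG : ∀ i, IsLinearized 𝐪 r (G i)) (hGH : ∀ i, IsCheckPoly 𝐪 r n (G i) (H i))
    (hDD' : IsCheckPoly 𝐪 r n D D') (hE : Fintype.card E = 𝐪 ^ r)
    (hEL : Module.finrank E L = n) (hr : 0 < r) (hn : 0 < n) :
    Module.finrank E (⨅ i, rootSpace E L (G i) : Submodule E L) = qDeg 𝐪 r D := by
  have hG0 : ∃ i, G i ≠ 0 := ⟨_, (hGH (Classical.arbitrary ι)).ne_zero Fintype.one_lt_card hr hn⟩
  rw [← rootSpace_eq_iInf_of_isRightGcd hE hr hG hG0 hD,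
    hDD'.finrank_rootSpace hD.isLinearized hE hEL hr hn]

theorem IsRightGcd.finrank_iSup_rootSpace_perp (hD : IsRightGcd 𝐪 r G D)
    (hG : ∀ i, IsLinearized 𝐪 r (G i)) (hGH : ∀ i, IsCheckPoly 𝐪 r n (G i) (H i))
    (hDD' : IsCheckPoly 𝐪 r n D D') (hE : Fintype.card E = 𝐪 ^ r)
    (hEL : Module.finrank E L = n) (hr : 0 < r) (hn : 0 < n) :
    Module.finrank E (⨆ i, rootSpace E L (perp 𝐪 r (H i)) : Submodule E L) =
      qDeg 𝐪 r (perp 𝐪 r D') := by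
  rw [← hD.rootSpace_perp_eq_iSup hG hGH hDD' hE hEL hr hn,
    hDD'.finrank_rootSpace_perp hD.isLinearized hE hEL hr hn]

end Family

end Duality

end SkewCyclic

open SkewCyclic in
theorem mainTheorem4
    {Fq K E L : Type*} [Field Fq] [Field K] [Field E] [Field L] [Fintype Fq]
    [Algebra Fq K] [Algebra Fq E] [Algebra Fq L] [Algebra K L] [Algebra E L]
    [IsScalarTower Fq K L] [IsScalarTower Fq E L]
    (q m n r : ℕ) (hm : 0 < m) (hn : 0 < n) (hr : 0 < r) (hmrn : m ∣ r * n)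
    (hq : Fintype.card Fq = q) (hK : Module.finrank Fq K = m)
    (hE : Module.finrank Fq E = r) (hL : Module.finrank Fq L = r * n)
    (C : Submodule K (Fin n → K)) (hC : IsSkewCyclic q r C)
    (G H : Polynomial K) (hG : IsGeneratorPoly q r C G) (hH : IsCheckPoly q r n G H) :
    (∃! D : Polynomial K, IsRightGcd q r (fun i : Fin m => frobPoly q i G) D) ∧
    (∃! M : Polynomial K, IsRightLcm q r (fun i : Fin m => frobPoly q i (perp q r H)) M) ∧
    (∀ D : Polynomial K, IsRightGcd q r (fun i : Fin m => frobPoly q i G) D →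
      (rankLength Fq C : ℤ) = (n : ℤ) - (qDeg q r D : ℤ)) ∧
    (∀ M : Polynomial K, IsRightLcm q r (fun i : Fin m => frobPoly q i (perp q r H)) M →
      rankLength Fq C = qDeg q r M) ∧
    (rankLength Fq C : ℤ) = (n : ℤ) -
      (Module.finrank E
        (⨅ i : Fin m, powSpace q i (rootSpace E L G) : Submodule E L) : ℤ) ∧
    rankLength Fq C =
      Module.finrank E
        (⨆ i : Fin m, powSpace q i (rootSpace E L (perp q r H)) : Submodule E L) := by
  subst hq hK
  have hq : 1 < Fintype.card Fq := Fintype.one_lt_card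
  have : Finite K := finite_of_finrank_pos hm
  have : Finite E := finite_of_finrank_pos (hE ▸ hr)
  have : Finite L := finite_of_finrank_pos (hL ▸ Nat.mul_pos hr hn)
  have : Fintype E := Fintype.ofFinite E
  have : Nonempty (Fin (Module.finrank Fq K)) := Fin.pos_iff_nonempty.1 hm
  have hEcard : Fintype.card E = Fintype.card Fq ^ r := hE ▸ Module.card_eq_pow_finrank
  have hEL : Module.finrank E L = n :=
    Nat.eq_of_mul_eq_mul_left hr (by rw [← hL, ← Module.finrank_mul_finrank Fq E L, hE])
  have hGi (i : Fin (Module.finrank Fq K)) := hG.isLinearized.frobPoly (i : ℕ)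
  have hGHi (i : Fin (Module.finrank Fq K)) := hH.frobPoly (i : ℕ)
  obtain ⟨D, D', hD, hDD'⟩ := exists_isRightGcd_isCheckPoly hmrn hr hn hGi hGHi
  have hlength := rankLength_add_qDeg_gcd hr hn hC hG hD
  have hdual := hDD'.qDeg_add_qDeg_perp hD.isLinearized hr hn
  have hM := hD.isRightLcm_perp hGi hGHi hDD' hEcard hEL hr hn
  have hinf := hD.finrank_iInf_rootSpace hGi hGHi hDD' hEcard hEL hr hn
  have hsup := hD.finrank_iSup_rootSpace_perp hGi hGHi hDD' hEcard hEL hr hn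
  rw [iInf_congr fun i : Fin _ => powSpace_rootSpace hEcard hG.isLinearized i,
    iSup_congr fun i : Fin _ => powSpace_rootSpace_perp hEcard H i]
  simp only [frobPoly_perp]
  refine ⟨⟨D, hD, fun _ h => h.unique hq hD⟩, ⟨_, hM, fun _ h => h.unique hq hM⟩,
    fun _ h => ?_, fun _ h => ?_, ?_, ?_⟩
  · rw [h.unique hq hD]; omega
  · rw [h.unique hq hM]; omega
  · omega
  · omega
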